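/- Let $S$ be a finite inverse semigroup, i.e. a finite semigroup in which every $s$ has a unique $s^*$ with $ss^*s=s$ and $s^*ss^*=s^*$. Let $X=\{x_s\mid s\in S\}$ be a set of variables, and let $\theta_S(X)=\det[x_{st}]_{s,t\in S}\in\mathbb C[X]$ be its semigroup determinant. Order $S$ by $s\le t$ iff $s=te$ for some idempotent $e$, and let $\mu_S$ be the Möbius function of this partial order. Let $r$ be the number of conjugacy classes of $S$, i.e. of classes of the smallest equivalence relation $\sim$ on $S$ with $ab\sim ba$ for all $a,b\in S$. Then $S$ has, up to equivalence, exactly $r$ irreducible complex (not identically zero) matrix representations $\rho_1,\dots,\rho_r$, and, with $d_i$ the degree of $\rho_i$, \[\theta_S=\prod_{i=1}^r P_i^{d_i},\] where $P_1,\dots,P_r\in\mathbb C[X]$ are irreducible homogeneous polynomials, $P_i$ has degree $d_i$, and the $P_i$ are distinct, even up to nonzero scalars. Moreover, $P_i$ determines the character $\chi_i$ of $\rho_i$: there is a nonzero constant $c_i$ such that for every $s\in S$ the substitution \[x_u\mapsto \#\{e\in S\mid e^2=e,\ e\le u\}\cdot T-\#\{v\in S\mid v\le u,\ v\le s\}\qquad(u\in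 S)\] turns $P_i$ into $c_i\det(T\cdot I-\rho_i(s))$, so that $\chi_i(s)$ is minus the coefficient of $T^{d_i-1}$ divided by the coefficient of $T^{d_i}$ in the resulting polynomial. Furthermore, let $\mathcal G(S)$ be the underlying groupoid of $S$: its objects are the idempotents of $S$, its arrows are the elements of $S$, with $s$ going from $s^*s$ to $ss^*$, and composition is the product of $S$ restricted to composable pairs. Let $\theta_{\mathcal G(S)}$ be the determinant of the $S\times S$ matrix whose $(s,t)$ entry is $x_{st}$ if $s^*s=tt^*$ and $0$ otherwise. For $s\in S$ put $y_s=\sum_{t\le s}\mu_S(t,s)x_t$, and put $Y=\{y_s\mid s\in S\}$. Then \[\theta_S(X)=\theta_{\mathcal G(S)}(Y).\] -/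

import Mathlib

/-- A semigroup `S` is an inverse semigroup if every `s` has a unique `t` with `s t s = s` and
`t s t = t`. -/
class IsInverseSemigroup (S : Type*) [Semigroup S] : Prop where
  existsUnique_inv : ∀ s : S, ∃! t : S, s * t * s = s ∧ t * s * t = t

namespace InverseSemigroup

section Basic

variable {S : Type*} [Semigroup S] [IsInverseSemigroup S]

/-- The inverse `s*` of an element `s` of an inverse semigroup. -/
noncomputable def inv (s : S) : S := (IsInverseSemigroup.existsUnique_inv s).choose

theorem mul_inv_mul (s : S) : s * inv s * s = s :=
  (IsInverseSemigroup.existsUnique_inv s).choose_spec.1.1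

theorem inv_mul_inv (s : S) : inv s * s * inv s = inv s :=
  (IsInverseSemigroup.existsUnique_inv s).choose_spec.1.2

theorem eq_inv {s t : S} (h₁ : s * t * s = s) (h₂ : t * s * t = t) : t = inv s :=
  (IsInverseSemigroup.existsUnique_inv s).choose_spec.2 t ⟨h₁, h₂⟩

theorem inv_idem {e : S} (he : e * e = e) : inv e = e :=
  (eq_inv (by rw [he, he]) (by rw [he, he])).symm

theorem inv_inv (s : S) : inv (inv s) = s :=
  (eq_inv (inv_mul_inv s) (mul_inv_mul s)).symm

theorem idem_inv_mul (s : S) : inv s * s * (inv s * s) = inv s * s := by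
  rw [← mul_assoc, inv_mul_inv]

theorem idem_mul_inv (s : S) : s * inv s * (s * inv s) = s * inv s := by
  rw [← mul_assoc, mul_inv_mul]

theorem idem_mul {e f : S} (he : e * e = e) (hf : f * f = f) : e * f * (e * f) = e * f := by
  have h₁ := mul_inv_mul (e * f)
  have h₂ := inv_mul_inv (e * f)
  have hx : f * inv (e * f) * e = inv (e * f) := by
    apply eq_inv
    · calc e * f * (f * inv (e * f) * e) * (e * f)
          = e * (f * f) * inv (e * f) * ((e * e) * f) := by simp only [mul_assoc]
        _ = e * f := by rw [he, hf, h₁]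
    · calc f * inv (e * f) * e * (e * f) * (f * inv (e * f) * e)
          = f * (inv (e * f) * ((e * e) * (f * f)) * inv (e * f)) * e := by simp only [mul_assoc]
        _ = f * inv (e * f) * e := by rw [he, hf, h₂]
  have hxx : inv (e * f) * inv (e * f) = inv (e * f) := by
    calc inv (e * f) * inv (e * f)
        = f * inv (e * f) * e * (f * inv (e * f) * e) := by rw [hx]
      _ = f * (inv (e * f) * (e * f) * inv (e * f)) * e := by simp only [mul_assoc]
      _ = inv (e * f) := by rw [h₂, hx]
  have h : e * f = inv (e * f) := by
    rw [← inv_idem hxx, inv_inv]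
  rw [h, hxx]

/-- Idempotents of an inverse semigroup commute. -/
theorem idem_comm {e f : S} (he : e * e = e) (hf : f * f = f) : e * f = f * e := by
  have hef := idem_mul he hf
  have hfe := idem_mul hf he
  have h : f * e = inv (e * f) := by
    apply eq_inv
    · calc e * f * (f * e) * (e * f) = e * (f * f) * ((e * e) * f) := by simp only [mul_assoc]
        _ = e * f := by rw [he, hf, hef]
    · calc f * e * (e * f) * (f * e) = f * (e * e) * ((f * f) * e) := by simp only [mul_assoc]
        _ = f * e := by rw [he, hf, hfe]
  rw [h, inv_idem hef]

/-- The inverse of a composable product. -/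
theorem inv_mul_of_composable {s t : S} (h : inv s * s = t * inv t) :
    inv (s * t) = inv t * inv s := by
  symm
  apply eq_inv
  · calc s * t * (inv t * inv s) * (s * t)
        = s * (t * inv t) * (inv s * s) * t := by simp only [mul_assoc]
      _ = s * (inv s * s * (inv s * s)) * t := by rw [← h]; simp only [mul_assoc]
      _ = s * t := by rw [idem_inv_mul, ← mul_assoc, mul_inv_mul]
  · calc inv t * inv s * (s * t) * (inv t * inv s)
        = inv t * (inv s * s) * (t * inv t) * inv s := by simp only [mul_assoc]
      _ = inv t * (t * inv t * (t * inv t)) * inv s := by rw [h]; simp only [mul_assoc]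
      _ = inv t * inv s := by rw [idem_mul_inv, ← mul_assoc, inv_mul_inv]

theorem dom_mul {s t : S} (h : inv s * s = t * inv t) : inv (s * t) * (s * t) = inv t * t := by
  rw [inv_mul_of_composable h]
  calc inv t * inv s * (s * t) = inv t * (inv s * s) * t := by simp only [mul_assoc]
    _ = inv t * t * inv t * t := by rw [h]; simp only [mul_assoc]
    _ = inv t * t := by rw [inv_mul_inv]

theorem ran_mul {s t : S} (h : inv s * s = t * inv t) : s * t * inv (s * t) = s * inv s := by
  rw [inv_mul_of_composable h]
  calc s * t * (inv t * inv s) = s * (t * inv t) * inv s := by simp only [mul_assoc]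
    _ = s * inv s * s * inv s := by rw [← h]; simp only [mul_assoc]
    _ = s * inv s := by rw [mul_inv_mul]

end Basic

section Order

variable (S : Type*) [Semigroup S] [IsInverseSemigroup S]

/-- The natural partial order of an inverse semigroup: `s ≤ t` iff `s = t e` for some
idempotent `e`. -/
abbrev naturalOrder : PartialOrder S where
  le s t := ∃ e : S, IsIdempotentElem e ∧ s = t * e
  le_refl s := ⟨inv s * s, idem_inv_mul s, by rw [← mul_assoc, mul_inv_mul]⟩
  le_trans := by
    rintro s t u ⟨e, he, rfl⟩ ⟨f, hf, rfl⟩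
    exact ⟨f * e, idem_mul hf he, by rw [mul_assoc]⟩
  le_antisymm := by
    rintro s t ⟨e, he, hs⟩ ⟨f, hf, ht⟩
    have hse : s * e = s := by
      rw [hs, mul_assoc, he.eq]
    calc s = s * f * e := by rw [← ht, ← hs]
      _ = s * e * f := by rw [mul_assoc, idem_comm hf.eq he.eq, ← mul_assoc]
      _ = t := by rw [hse, ← ht]

variable {S}

/-- The relation `s ≤ t` of the natural partial order. -/
def NatLE (s t : S) : Prop := (naturalOrder S).le s t

open Classical in
/-- The Möbius function `μ_S` of the natural partial order of a finite inverse semigroup. -/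
noncomputable def moebius [Fintype S] (s t : S) : ℤ :=
  letI := naturalOrder S
  letI : LocallyFiniteOrder S := Fintype.toLocallyFiniteOrder
  IncidenceAlgebra.mu ℤ s t

open Classical in
/-- The linear form `y_s = ∑_{t ≤ s} μ_S(t, s) x_t`. -/
noncomputable def yForm [Fintype S] (s : S) : MvPolynomial S ℂ :=
  ∑ t : S with NatLE t s, MvPolynomial.C (moebius t s : ℂ) * MvPolynomial.X t

end Order

section Groupoid

variable (S : Type*) [Semigroup S] [IsInverseSemigroup S]

/-- The objects of the underlying groupoid of `S`: the idempotents of `S`. -/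
structure UnderlyingGroupoid where
  /-- the idempotent -/
  val : S
  idem : IsIdempotentElem val

variable {S}

/-- The arrows `e ⟶ f` of the underlying groupoid: the `s` with `s* s = e` and `s s* = f`. -/
@[ext]
structure UnderlyingGroupoid.Hom (e f : UnderlyingGroupoid S) where
  /-- the element of `S` -/
  val : S
  dom : inv val * val = e.val
  ran : val * inv val = f.val

/-- The underlying groupoid of `S`. Composition is the product of `S`, inversion is `s ↦ s*`;
`f ≫ g` ("first `f`, then `g`") is the product `g f`. -/
noncomputable instance : CategoryTheory.Groupoid (UnderlyingGroupoid S) where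
  Hom := UnderlyingGroupoid.Hom
  id e := ⟨e.val, by rw [inv_idem e.idem.eq, e.idem.eq], by rw [inv_idem e.idem.eq, e.idem.eq]⟩
  comp f g := ⟨g.val * f.val, (dom_mul (g.dom.trans f.ran.symm)).trans f.dom,
    (ran_mul (g.dom.trans f.ran.symm)).trans g.ran⟩
  id_comp f := UnderlyingGroupoid.Hom.ext (by
    have h : f.val * (inv f.val * f.val) = f.val := by rw [← mul_assoc, mul_inv_mul]
    rw [f.dom] at h
    exact h)
  comp_id f := UnderlyingGroupoid.Hom.ext (by
    have h := mul_inv_mul f.val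
    rw [f.ran] at h
    exact h)
  assoc f g h := UnderlyingGroupoid.Hom.ext (by
    change h.val * (g.val * f.val) = h.val * g.val * f.val
    rw [mul_assoc])
  inv f := ⟨inv f.val, by rw [inv_inv, f.ran], by rw [inv_inv, f.dom]⟩
  inv_comp f := UnderlyingGroupoid.Hom.ext f.ran
  comp_inv f := UnderlyingGroupoid.Hom.ext f.dom

/-- The element of `S` underlying an arrow of its groupoid. -/
noncomputable def arrowElem (a : CategoryTheory.Arrow (UnderlyingGroupoid S)) : S :=
  UnderlyingGroupoid.Hom.val a.hom

/-- The arrows of the underlying groupoid are the elements of `S`. -/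
theorem arrowElem_bijective : Function.Bijective (arrowElem (S := S)) := by
  constructor
  · rintro ⟨⟨e, he⟩, ⟨f, hf⟩, ⟨s, h₁, h₂⟩⟩ ⟨⟨e', he'⟩, ⟨f', hf'⟩, ⟨s', h₁', h₂'⟩⟩ h
    change s = s' at h
    change inv s * s = e at h₁
    change s * inv s = f at h₂
    change inv s' * s' = e' at h₁'
    change s' * inv s' = f' at h₂'
    subst h h₁ h₂ h₁' h₂'
    rfl
  · intro s
    exact ⟨CategoryTheory.Arrow.mk (X := (⟨inv s * s, idem_inv_mul s⟩ : UnderlyingGroupoid S))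
      (Y := ⟨s * inv s, idem_mul_inv s⟩) (UnderlyingGroupoid.Hom.mk s rfl rfl), rfl⟩

noncomputable instance [Fintype S] : Fintype (CategoryTheory.Arrow (UnderlyingGroupoid S)) :=
  Fintype.ofInjective arrowElem arrowElem_bijective.1

end Groupoid

end InverseSemigroup

section Determinants

open Classical in
/-- The semigroup determinant `θ_S`: the determinant of the `S × S` matrix with entries `x_{st}`. -/
noncomputable def semigroupDet (S : Type*) [Semigroup S] [Fintype S] : MvPolynomial S ℂ :=
  Matrix.det (Matrix.of fun s t : S => (MvPolynomial.X (s * t) : MvPolynomial S ℂ))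

open Classical CategoryTheory in
/-- The determinant `θ_𝒞` of a category with finitely many arrows: the determinant of the matrix,
indexed by the arrows, whose `(a, b)` entry is `x_{ab}` if the domain of `a` is the range of `b`
(where `ab` is "first `b`, then `a`") and `0` otherwise. -/
noncomputable def categoryDet (𝒞 : Type*) [Category 𝒞] [Fintype (Arrow 𝒞)] :
    MvPolynomial (Arrow 𝒞) ℂ :=
  Matrix.det (Matrix.of fun a b : Arrow 𝒞 =>
    if h : b.right = a.left then
      (MvPolynomial.X (Arrow.mk (b.hom ≫ eqToHom h ≫ a.hom)) : MvPolynomial (Arrow 𝒞) ℂ)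
    else 0)

end Determinants

section Representations

variable {S : Type*} [Semigroup S]

/-- A matrix representation of a semigroup is irreducible if it is not identically zero and has no
invariant subspaces other than `0` and the whole space. -/
def IsIrreducibleRep {d : ℕ} (ρ : S →ₙ* Matrix (Fin d) (Fin d) ℂ) : Prop :=
  (∃ s, ρ s ≠ 0) ∧
    ∀ W : Submodule ℂ (Fin d → ℂ), (∀ s, ∀ w ∈ W, (ρ s).mulVec w ∈ W) → W = ⊥ ∨ W = ⊤

/-- Equivalence of matrix representations. -/
def RepEquiv {d e : ℕ} (ρ : S →ₙ* Matrix (Fin d) (Fin d) ℂ)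
    (σ : S →ₙ* Matrix (Fin e) (Fin e) ℂ) : Prop :=
  ∃ T : (Fin d → ℂ) ≃ₗ[ℂ] (Fin e → ℂ), ∀ s v, T ((ρ s).mulVec v) = (σ s).mulVec (T v)

variable (S) in
/-- Conjugacy on a semigroup: the smallest equivalence relation with `ab ∼ ba` for all `a, b`. -/
def conjSetoid : Setoid S :=
  Relation.EqvGen.setoid fun x y => ∃ a b : S, x = a * b ∧ y = b * a

variable (S) in
/-- The number of conjugacy classes of a semigroup. -/
noncomputable def numConjClasses : ℕ := Nat.card (Quotient (conjSetoid S))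

open Classical Polynomial in
/-- The one-variable polynomial obtained from `P` by substituting, for each variable `x_u`,
`#{e idempotent | e ≤ u} T - #{v | v ≤ u and v ≤ s}`. -/
noncomputable def specializeAt [IsInverseSemigroup S] [Fintype S] (s : S)
    (P : MvPolynomial S ℂ) : ℂ[X] :=
  MvPolynomial.aeval (fun u : S =>
    ((Finset.univ.filter fun e : S =>
        IsIdempotentElem e ∧ InverseSemigroup.NatLE e u).card : ℂ[X]) * Polynomial.X -
      ((Finset.univ.filter fun v : S =>
        InverseSemigroup.NatLE v u ∧ InverseSemigroup.NatLE v s).card : ℂ[X])) P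

end Representations

/-! Work in the algebra of the underlying groupoid, with the arrows as basis. The map sending `s` to
`lower s`, the sum of all `t ≤ s`, is multiplicative (`lower_mul`), and Möbius inversion makes its
image a basis (`lowerBasis`): this is the semigroup algebra of `S` in a better basis. In these terms
the matrix `[x_{st}]` is `Z C Zᵀ`, with `Z` the zeta matrix and `C` the matrix `[y_{st}]` restricted
to composable pairs (`of_mul_eq`). Since `det Z = ±1`, this gives the reduction to the groupoid.

Permuting the columns of `C` by `s ↦ s*` yields left multiplication by `f = ∑ y_s s`, so up to sign
`θ_S` is the algebra norm of `f`. The algebra is closed under adjoints for the standard Hermitian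
form, hence semisimple, hence a product of matrix algebras; there the norm is `∏ det(f_i)^{d_i}`
(`norm_eq_prod_det`). The entries of all the `f_i` together are linear coordinates on `ℂ^S`, so each
`det f_i` is a determinant of independent variables, which is irreducible
(`irreducible_genericDet`).

The factors of the algebra are the irreducible representations of `S`; comparing class functions
with combinations of traces counts them (`card_factors`). The prescribed substitution turns `f` into
`T·1 - lower s`, so `det f_i` becomes the characteristic polynomial of `ρ_i(s)`
(`specializeAt_factorPoly`). -/

namespace InverseSemigroup

/-! ### Products and restrictions in the natural order. -/

section Lemmas

variable {S : Type*} [Semigroup S] [IsInverseSemigroup S]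

theorem inv_mul_rev (s t : S) : inv (s * t) = inv t * inv s := by
  symm
  have hc := idem_comm (idem_mul_inv t) (idem_inv_mul s)
  apply eq_inv
  · calc s * t * (inv t * inv s) * (s * t)
        = s * ((t * inv t) * (inv s * s)) * t := by simp only [mul_assoc]
      _ = s * inv s * s * (t * inv t * t) := by rw [hc]; simp only [mul_assoc]
      _ = s * t := by rw [mul_inv_mul, mul_inv_mul]
  · calc inv t * inv s * (s * t) * (inv t * inv s)
        = inv t * ((inv s * s) * (t * inv t)) * inv s := by simp only [mul_assoc]
      _ = inv t * t * inv t * (inv s * s * inv s) := by rw [← hc]; simp only [mul_assoc]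
      _ = inv t * inv s := by rw [inv_mul_inv, inv_mul_inv]

theorem mul_dom (s : S) : s * (inv s * s) = s := by rw [← mul_assoc, mul_inv_mul]

theorem natLE_mul_idem (t : S) {e : S} (he : e * e = e) : NatLE (t * e) t := ⟨e, he, rfl⟩

/-- `e t ≤ t` for an idempotent `e`. -/
theorem natLE_idem_mul (t : S) {e : S} (he : e * e = e) : NatLE (e * t) t := by
  have hc := idem_comm he (idem_mul_inv t)
  -- The conjugate `t* e t` moves `e` to the right of `t`, because `e` commutes with `t t*`.
  refine ⟨inv t * e * t, ?_, ?_⟩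
  · change inv t * e * t * (inv t * e * t) = _
    calc inv t * e * t * (inv t * e * t)
        = inv t * (e * (t * inv t)) * e * t := by simp only [mul_assoc]
      _ = (inv t * t * inv t) * (e * e) * t := by rw [hc]; simp only [mul_assoc]
      _ = inv t * e * t := by rw [inv_mul_inv, he]
  · calc e * t = e * (t * inv t) * t := by rw [mul_assoc, mul_inv_mul]
      _ = t * (inv t * e * t) := by rw [hc]; simp only [mul_assoc]

/-- The domain idempotent of `s` always serves as witness, so an element below `t` is determined by
its domain. -/
theorem natLE_iff {s t : S} : NatLE s t ↔ s = t * (inv s * s) := by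
  constructor
  · rintro ⟨e, he, hs⟩
    have hse : s * e = s := by rw [hs, mul_assoc, he.eq]
    calc s = s * (inv s * s) := (mul_dom s).symm
      _ = t * (e * (inv s * s)) := by rw [← mul_assoc t, ← hs]
      _ = t * (inv s * (s * e)) := by rw [idem_comm he.eq (idem_inv_mul s), mul_assoc]
      _ = t * (inv s * s) := by rw [hse]
  · intro h
    exact ⟨inv s * s, idem_inv_mul s, h⟩

theorem natLE_mul {a b s t : S} (h₁ : NatLE a s) (h₂ : NatLE b t) : NatLE (a * b) (s * t) := by
  obtain ⟨e, he, rfl⟩ := h₁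
  obtain ⟨f, hf, rfl⟩ := h₂
  obtain ⟨g, hg, h⟩ := natLE_idem_mul t he.eq
  refine ⟨g * f, idem_mul hg.eq hf.eq, ?_⟩
  calc s * e * (t * f) = s * (e * t) * f := by simp only [mul_assoc]
    _ = s * t * (g * f) := by rw [h]; simp only [mul_assoc]

theorem eq_of_natLE_of_dom_eq {s t : S} (h : NatLE s t) (hd : inv s * s = inv t * t) : s = t := by
  rw [natLE_iff.1 h, hd, mul_dom]

/-- For `u ≤ s t`, the restriction `w` of `t` to the domain of `u` is the unique `w ≤ t` with the
domain of `u` and `u w* ≤ s`; if `u ≰ s t`, there is no such `w`. -/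
theorem restriction_iff {s t u w : S} :
    (inv u * u = inv w * w ∧ NatLE (u * inv w) s ∧ NatLE w t) ↔
      (w = t * (inv u * u) ∧ NatLE u (s * t)) := by
  constructor
  · rintro ⟨hd, h₁, h₂⟩
    refine ⟨by rw [hd]; exact natLE_iff.1 h₂, ?_⟩
    have := natLE_mul h₁ h₂
    rwa [mul_assoc, ← hd, mul_dom] at this
  · rintro ⟨rfl, h⟩
    have hu := natLE_iff.1 h
    have hc := idem_comm (idem_inv_mul u) (idem_inv_mul t)
    -- The domain of `u` lies below that of `t`, so restricting `t` to it loses nothing.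
    have hut : u * (inv t * t) = u := by
      conv_lhs => rw [hu, mul_assoc, hc, mul_assoc, ← mul_assoc t, mul_dom, ← mul_assoc, ← hu]
    have hw : inv (t * (inv u * u)) = inv u * u * inv t := by
      rw [inv_mul_rev, inv_idem (idem_inv_mul u)]
    refine ⟨?_, ?_, natLE_mul_idem t (idem_inv_mul u)⟩
    · calc inv u * u = inv u * (u * (inv t * t)) := by rw [hut]
        _ = (inv u * u) * (inv u * u) * (inv t * t) := by rw [idem_inv_mul, mul_assoc]
        _ = inv (t * (inv u * u)) * (t * (inv u * u)) := by
          rw [hw, mul_assoc, hc]; simp only [mul_assoc]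
    · have : u * inv (t * (inv u * u)) =
          s * ((t * (inv u * u)) * inv (t * (inv u * u))) := by
        calc u * inv (t * (inv u * u)) = s * t * (inv u * u) * inv (t * (inv u * u)) := by
              rw [← hu]
          _ = _ := by simp only [mul_assoc]
      rw [this]
      exact natLE_mul_idem s (idem_mul_inv _)

theorem inv_bijective : Function.Bijective (inv : S → S) :=
  Function.Involutive.bijective inv_inv

end Lemmas

end InverseSemigroup

/-! ### The groupoid algebra and its semisimplicity. -/

open InverseSemigroup

/-- The complex algebra of the underlying groupoid of `S`. -/
@[ext]
structure GroupoidAlgebra (S : Type*) where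
  /-- the coefficients of an element with respect to the arrows of the groupoid -/
  coeff : S → ℂ

namespace GroupoidAlgebra

/-- An element of the groupoid algebra is a function on the arrows. -/
def coeffEquiv (S : Type*) : GroupoidAlgebra S ≃ (S → ℂ) := ⟨coeff, mk, fun _ => rfl, fun _ => rfl⟩

noncomputable section

instance (S : Type*) : AddCommGroup (GroupoidAlgebra S) := (coeffEquiv S).addCommGroup
instance (S : Type*) : Module ℂ (GroupoidAlgebra S) := (coeffEquiv S).module ℂ

/-- The coefficients as a linear equivalence. -/
def coeffₗ (S : Type*) : GroupoidAlgebra S ≃ₗ[ℂ] (S → ℂ) :=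
  { coeffEquiv S with
    map_add' := fun _ _ => rfl
    map_smul' := fun _ _ => rfl }

theorem coeffₗ_symm_coeff {S : Type*} (f : S → ℂ) : ((coeffₗ S).symm f).coeff = f := rfl

theorem coeff_add {S : Type*} (f g : GroupoidAlgebra S) : (f + g).coeff = f.coeff + g.coeff := rfl

theorem coeff_smul {S : Type*} (c : ℂ) (f : GroupoidAlgebra S) : (c • f).coeff = c • f.coeff := rfl

theorem coeff_zero {S : Type*} : (0 : GroupoidAlgebra S).coeff = 0 := rfl

instance (S : Type*) [Finite S] : Module.Finite ℂ (GroupoidAlgebra S) :=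
  Module.Finite.equiv (coeffₗ S).symm

variable {S : Type*} [Semigroup S] [IsInverseSemigroup S]

open Classical in
/-- The matrix of left multiplication by `f` in the groupoid algebra. -/
def leftMatrix (f : S → ℂ) : Matrix S S ℂ :=
  Matrix.of fun u w => if inv u * u = inv w * w then f (u * inv w) else 0

theorem leftMatrix_apply (f : S → ℂ) (u w : S) [Decidable (inv u * u = inv w * w)] :
    leftMatrix f u w = if inv u * u = inv w * w then f (u * inv w) else 0 := by
  simp only [leftMatrix, Matrix.of_apply]
  congr

theorem leftMatrix_add (f g : S → ℂ) : leftMatrix (f + g) = leftMatrix f + leftMatrix g := by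
  classical
  ext u w
  simp only [leftMatrix_apply, Matrix.add_apply, Pi.add_apply]
  split_ifs <;> simp

theorem leftMatrix_smul (c : ℂ) (f : S → ℂ) : leftMatrix (c • f) = c • leftMatrix f := by
  classical
  ext u w
  simp only [leftMatrix_apply, Matrix.smul_apply, Pi.smul_apply]
  split_ifs <;> simp

theorem leftMatrix_zero : leftMatrix (0 : S → ℂ) = 0 := by
  simpa using leftMatrix_smul 0 (0 : S → ℂ)

/-- Follows from `(u w*)* = w u*`. This closure under adjoints is what makes the algebra semisimple.
-/
theorem leftMatrix_conjTranspose (f : S → ℂ) :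
    (leftMatrix f).conjTranspose = leftMatrix (fun s => star (f (inv s))) := by
  classical
  ext u w
  rw [Matrix.conjTranspose_apply, leftMatrix_apply, leftMatrix_apply]
  by_cases h : inv u * u = inv w * w
  · rw [if_pos h, if_pos h.symm, inv_mul_rev, InverseSemigroup.inv_inv]
  · rw [if_neg h, if_neg (Ne.symm h), star_zero]

theorem dom_mul_inv {u w : S} (h : inv u * u = inv w * w) :
    inv (u * inv w) * (u * inv w) = w * inv w := by
  rw [dom_mul (by rw [InverseSemigroup.inv_inv, h]), InverseSemigroup.inv_inv]

variable [Fintype S]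

/-- Associativity of convolution in matrix form. Right multiplication by `w` matches the arrows with
domain `w w*` to those with domain `w* w`, which reindexes one sum into the other. -/
theorem leftMatrix_mul (f g : S → ℂ) :
    leftMatrix ((leftMatrix f).mulVec g) = leftMatrix f * leftMatrix g := by
  classical
  ext u w
  have hR : (leftMatrix f * leftMatrix g) u w = ∑ v : S with inv v * v = inv w * w,
      leftMatrix f u v * g (v * inv w) := by
    rw [Matrix.mul_apply, Finset.sum_filter]
    refine Finset.sum_congr rfl fun v _ => ?_
    rw [leftMatrix_apply g]
    split_ifs <;> simp
  rw [hR, leftMatrix_apply]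
  split_ifs with h
  · have hL : (leftMatrix f).mulVec g (u * inv w) = ∑ v : S with inv v * v = w * inv w,
        f (u * inv w * inv v) * g v := by
      rw [Matrix.mulVec, dotProduct, Finset.sum_filter]
      refine Finset.sum_congr rfl fun v _ => ?_
      rw [leftMatrix_apply f, dom_mul_inv h]
      by_cases hv : inv v * v = w * inv w
      · rw [if_pos hv, if_pos hv.symm]
      · rw [if_neg hv, if_neg (Ne.symm hv), zero_mul]
    rw [hL]
    refine Finset.sum_nbij' (fun v => v * w) (fun v => v * inv w) ?_ ?_ ?_ ?_ ?_
    · intro v hv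
      simp only [Finset.mem_filter, Finset.mem_univ, true_and] at hv ⊢
      exact dom_mul hv
    · intro v hv
      simp only [Finset.mem_filter, Finset.mem_univ, true_and] at hv ⊢
      exact dom_mul_inv hv
    · intro v hv
      simp only [Finset.mem_filter, Finset.mem_univ, true_and] at hv
      rw [mul_assoc, ← hv, mul_dom]
    · intro v hv
      simp only [Finset.mem_filter, Finset.mem_univ, true_and] at hv
      rw [mul_assoc, ← hv, mul_dom]
    · intro v hv
      simp only [Finset.mem_filter, Finset.mem_univ, true_and] at hv
      have h2 : inv (v * w) * (v * w) = inv w * w := dom_mul hv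
      rw [leftMatrix_apply, if_pos (h.trans h2.symm), inv_mul_rev, mul_assoc v, ← hv, mul_dom,
        mul_assoc]
  · symm
    apply Finset.sum_eq_zero
    intro v hv
    simp only [Finset.mem_filter, Finset.mem_univ, true_and] at hv
    rw [leftMatrix_apply, if_neg (fun h2 => h (h2.trans hv)), zero_mul]

instance : Mul (GroupoidAlgebra S) := ⟨fun f g => ⟨(leftMatrix f.coeff).mulVec g.coeff⟩⟩

theorem coeff_mul (f g : GroupoidAlgebra S) :
    (f * g).coeff = (leftMatrix f.coeff).mulVec g.coeff := rfl

open Classical in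
instance (S : Type*) [Semigroup S] : One (GroupoidAlgebra S) :=
  ⟨⟨fun s => if IsIdempotentElem s then 1 else 0⟩⟩

open Classical in
theorem coeff_one {S : Type*} [Semigroup S] (s : S) :
    (1 : GroupoidAlgebra S).coeff s = if IsIdempotentElem s then (1 : ℂ) else 0 := rfl

omit [Fintype S] in
theorem leftMatrix_one [DecidableEq S] : leftMatrix (1 : GroupoidAlgebra S).coeff = 1 := by
  classical
  ext u w
  rw [leftMatrix_apply, Matrix.one_apply]
  by_cases huw : u = w
  · subst huw
    rw [if_pos rfl, if_pos rfl, coeff_one, if_pos (show IsIdempotentElem _ from idem_mul_inv u)]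
  · rw [if_neg huw]
    split_ifs with h
    · rw [coeff_one, if_neg]
      intro hi
      apply huw
      -- If `u w*` is idempotent, then `u = (u w*) w ≤ w`; equal domains force `u = w`.
      have := natLE_idem_mul w hi.eq
      rw [mul_assoc, ← h, mul_dom] at this
      exact eq_of_natLE_of_dom_eq this h
    · rfl

theorem leftMatrix_mulVec_one (f : S → ℂ) :
    (leftMatrix f).mulVec (1 : GroupoidAlgebra S).coeff = f := by
  classical
  funext u
  rw [Matrix.mulVec, dotProduct, Finset.sum_eq_single (inv u * u)]
  · rw [leftMatrix_apply, coeff_one, if_pos (show IsIdempotentElem _ from idem_inv_mul u),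
      inv_idem (idem_inv_mul u), if_pos (idem_inv_mul u).symm, mul_dom, mul_one]
  · intro w _ hw
    rw [leftMatrix_apply, coeff_one]
    split_ifs with h1 h2
    · exact absurd (by rw [h1, inv_idem h2.eq, h2.eq]) hw
    all_goals simp
  · simp

instance : Ring (GroupoidAlgebra S) where
  __ := (inferInstance : AddCommGroup (GroupoidAlgebra S))
  left_distrib f g h := GroupoidAlgebra.ext (Matrix.mulVec_add _ _ _)
  right_distrib f g h := GroupoidAlgebra.ext <| by
    simp only [coeff_mul, coeff_add, leftMatrix_add, Matrix.add_mulVec]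
  zero_mul f := GroupoidAlgebra.ext <| by
    simp only [coeff_mul, coeff_zero, leftMatrix_zero, Matrix.zero_mulVec]
  mul_zero f := GroupoidAlgebra.ext (Matrix.mulVec_zero _)
  mul_assoc f g h := GroupoidAlgebra.ext <| by
    simp only [coeff_mul, leftMatrix_mul, Matrix.mulVec_mulVec]
  one_mul f := GroupoidAlgebra.ext <| by
    classical
    rw [coeff_mul, leftMatrix_one, Matrix.one_mulVec]
  mul_one f := GroupoidAlgebra.ext (leftMatrix_mulVec_one _)

instance : Algebra ℂ (GroupoidAlgebra S) :=
  Algebra.ofModule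
    (fun c f g => GroupoidAlgebra.ext <| by
      simp only [coeff_mul, coeff_smul, leftMatrix_smul, Matrix.smul_mulVec])
    (fun c f g => GroupoidAlgebra.ext <| by
      simp only [coeff_mul, coeff_smul, Matrix.mulVec_smul])

open Classical in
/-- The image of `s` in the groupoid algebra: the sum of all `t ≤ s`. -/
def lower (s : S) : GroupoidAlgebra S := ⟨fun t => if NatLE t s then 1 else 0⟩

omit [Fintype S] in
open Classical in
theorem coeff_lower (s t : S) : (lower s).coeff t = if NatLE t s then (1 : ℂ) else 0 := rfl

theorem lower_mul (s t : S) : lower s * lower t = lower (s * t) := by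
  classical
  ext u
  rw [coeff_mul, Matrix.mulVec, dotProduct]
  -- Each arrow `u ≤ s t` factors in exactly one way as an arrow below `s` times an arrow below `t`,
  -- the latter being `t` restricted to the domain of `u`.
  have key : ∀ w, leftMatrix (lower s).coeff u w * (lower t).coeff w =
      if w = t * (inv u * u) then (lower (s * t)).coeff u else 0 := by
    intro w
    have := restriction_iff (s := s) (t := t) (u := u) (w := w)
    rw [leftMatrix_apply, coeff_lower, coeff_lower, coeff_lower]
    split_ifs <;> first | (simp; done) | (exfalso; tauto)
  simp [key]

/-- The orthogonal complement of a left ideal of the groupoid algebra is a left ideal. -/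
def orthogonalIdeal (p : Submodule (GroupoidAlgebra S) (GroupoidAlgebra S)) :
    Submodule (GroupoidAlgebra S) (GroupoidAlgebra S) where
  carrier := {g | ∀ f ∈ p, star f.coeff ⬝ᵥ g.coeff = 0}
  add_mem' := by
    intro a b ha hb f hf
    rw [coeff_add, dotProduct_add, ha f hf, hb f hf, add_zero]
  zero_mem' := fun f _ => dotProduct_zero _
  smul_mem' := by
    intro c g hg f hf
    -- Left multiplication by `c` is moved across the form to its adjoint, which preserves the left
    -- ideal `p`.
    have h := hg _ (p.smul_mem (⟨fun s => star (c.coeff (inv s))⟩ : GroupoidAlgebra S) hf)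
    rwa [smul_eq_mul, coeff_mul, ← leftMatrix_conjTranspose, Matrix.star_mulVec,
      Matrix.conjTranspose_conjTranspose, ← Matrix.dotProduct_mulVec] at h

-- A Maschke-type argument: the orthogonal complement is a complementary left ideal. Positivity of
-- the form gives disjointness, and orthogonal projection in `EuclideanSpace` gives spanning.
open ComplexOrder in
instance : IsSemisimpleRing (GroupoidAlgebra S) := by
  refine (isSemisimpleModule_iff _ _).2 ⟨fun p => ⟨orthogonalIdeal p, ?_, ?_⟩⟩
  · rw [Submodule.disjoint_def]
    intro f hf hq
    exact GroupoidAlgebra.ext (dotProduct_star_self_eq_zero.1 (hq f hf))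
  · rw [Submodule.codisjoint_iff_exists_add_eq]
    intro z
    let L : GroupoidAlgebra S ≃ₗ[ℂ] EuclideanSpace ℂ S :=
      (coeffₗ S).trans (WithLp.linearEquiv 2 ℂ (S → ℂ)).symm
    obtain ⟨a, ha, b, hb, hab⟩ :=
      ((p.restrictScalars ℂ).map L.toLinearMap).exists_add_mem_mem_orthogonal (L z)
    refine ⟨L.symm a, L.symm b, ?_, ?_, ?_⟩
    · obtain ⟨x, hx, rfl⟩ := ha
      change L.symm (L x) ∈ p
      rw [LinearEquiv.symm_apply_apply]
      exact hx
    · intro f hf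
      have := (Submodule.mem_orthogonal _ _).1 hb (L f) ⟨f, hf, rfl⟩
      rw [EuclideanSpace.inner_eq_star_dotProduct, dotProduct_comm] at this
      exact this
    · rw [← map_add, ← hab, LinearEquiv.symm_apply_apply]

end

end GroupoidAlgebra

/-! ### Möbius inversion and the groupoid determinant. -/

namespace GroupoidAlgebra

noncomputable section

variable {S : Type*} [Semigroup S] [IsInverseSemigroup S]

open Classical in
/-- The matrix of the zeta function of the natural partial order, `(s, t) ↦ [t ≤ s]`. -/
def zetaMatrix (S : Type*) [Semigroup S] [IsInverseSemigroup S] : Matrix S S ℂ :=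
  Matrix.of fun s t => if NatLE t s then 1 else 0

open Classical in
/-- The matrix of the Möbius function of the natural partial order. -/
def moebiusMatrix (S : Type*) [Semigroup S] [IsInverseSemigroup S] [Fintype S] : Matrix S S ℂ :=
  Matrix.of fun s t => if NatLE t s then (moebius t s : ℂ) else 0

theorem zetaMatrix_apply (s t : S) : zetaMatrix S s t = (lower s).coeff t := rfl

variable [Fintype S]

open Classical in
theorem sum_moebius (u s : S) :
    ∑ t : S with NatLE u t ∧ NatLE t s, moebius u t = if u = s then 1 else 0 := by
  classical
  let _ := naturalOrder S
  let _ : LocallyFiniteOrder S := Fintype.toLocallyFiniteOrder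
  have h := IncidenceAlgebra.sum_Icc_mu_right (𝕜 := ℤ) u s
  have hI : Finset.Icc u s = Finset.univ.filter fun t => NatLE u t ∧ NatLE t s := by
    ext t
    rw [Finset.mem_Icc, Finset.mem_filter]
    simp only [Finset.mem_univ, true_and]
    rfl
  rw [hI] at h
  convert h using 2
  simp only [moebius]

theorem zetaMatrix_mul_moebiusMatrix [DecidableEq S] : zetaMatrix S * moebiusMatrix S = 1 := by
  classical
  ext s u
  have h := congrArg (Int.cast : ℤ → ℂ) (sum_moebius u s)
  rw [Int.cast_sum, Finset.sum_filter] at h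
  rw [Matrix.mul_apply, Matrix.one_apply]
  calc _ = _ := Finset.sum_congr rfl fun t _ => ?_
    _ = _ := h
    _ = _ := ?_
  · simp only [zetaMatrix, moebiusMatrix, Matrix.of_apply]
    split_ifs <;> first | (simp; done) | (exfalso; tauto)
  · by_cases hu : u = s <;> simp [hu, Ne.symm]

theorem moebiusMatrix_mul_zetaMatrix [DecidableEq S] : moebiusMatrix S * zetaMatrix S = 1 :=
  mul_eq_one_comm.1 zetaMatrix_mul_moebiusMatrix

open Classical in
/-- Möbius inversion: the linear automorphism `x ↦ y` with `y_s = ∑_{t ≤ s} μ_S(t, s) x_t`. -/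
def moebiusEquiv (S : Type*) [Semigroup S] [IsInverseSemigroup S] [Fintype S] :
    (S → ℂ) ≃ₗ[ℂ] (S → ℂ) :=
  LinearEquiv.ofLinearMap (moebiusMatrix S).toLin' (zetaMatrix S).toLin'
    (by rw [← Matrix.toLin'_mul, moebiusMatrix_mul_zetaMatrix, Matrix.toLin'_one])
    (by rw [← Matrix.toLin'_mul, zetaMatrix_mul_moebiusMatrix, Matrix.toLin'_one])

theorem moebiusEquiv_apply (x : S → ℂ) : moebiusEquiv S x = (moebiusMatrix S).mulVec x := by
  classical
  exact Matrix.toLin'_apply _ _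

theorem moebiusEquiv_symm_apply (y : S → ℂ) :
    (moebiusEquiv S).symm y = (zetaMatrix S).mulVec y := by
  classical
  exact Matrix.toLin'_apply _ _

theorem eval_yForm (x : S → ℂ) (s : S) :
    MvPolynomial.eval x (yForm s) = moebiusEquiv S x s := by
  classical
  rw [moebiusEquiv_apply, yForm, map_sum, Finset.sum_filter, Matrix.mulVec, dotProduct]
  refine Finset.sum_congr rfl fun t _ => ?_
  simp only [moebiusMatrix, Matrix.of_apply]
  by_cases h : NatLE t s
  · rw [if_pos h, if_pos h]
    simp
  · rw [if_neg h, if_neg h, zero_mul]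

/-- The zeta and Möbius matrices are mutually inverse integer matrices, so the determinant is a unit
of `ℤ`. The sign is irrelevant because `Z` occurs twice. -/
theorem det_zetaMatrix_sq [DecidableEq S] : (zetaMatrix S).det * (zetaMatrix S).det = 1 := by
  classical
  let Z : Matrix S S ℤ := Matrix.of fun s t => if NatLE t s then 1 else 0
  let M : Matrix S S ℤ := Matrix.of fun s t => if NatLE t s then moebius t s else 0
  have hZ : Z.map (Int.castRingHom ℂ) = zetaMatrix S := by
    ext s t
    simp only [Z, zetaMatrix, Matrix.map_apply, Matrix.of_apply]
    split_ifs <;> simp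
  have hM : M.map (Int.castRingHom ℂ) = moebiusMatrix S := by
    ext s t
    simp only [M, moebiusMatrix, Matrix.map_apply, Matrix.of_apply]
    split_ifs <;> simp
  have hd : (zetaMatrix S).det = ((Z.det : ℤ) : ℂ) := by
    rw [← hZ]
    exact ((Int.castRingHom ℂ).map_det Z).symm
  have hd' : (moebiusMatrix S).det = ((M.det : ℤ) : ℂ) := by
    rw [← hM]
    exact ((Int.castRingHom ℂ).map_det M).symm
  have h1 : Z.det * M.det = 1 := by
    have := congrArg Matrix.det (zetaMatrix_mul_moebiusMatrix (S := S))
    rw [Matrix.det_mul, Matrix.det_one, hd, hd'] at this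
    exact_mod_cast this
  rw [hd]
  rcases Int.isUnit_iff.1 (IsUnit.of_mul_eq_one _ h1) with h | h <;> rw [h] <;> norm_num

open Classical in
/-- The matrix `[y_{st}]`, restricted to composable pairs. -/
def composableMatrix (y : S → ℂ) : Matrix S S ℂ :=
  Matrix.of fun s t => if inv s * s = t * inv t then y (s * t) else 0

omit [Fintype S] in
theorem composableMatrix_apply (y : S → ℂ) (s t : S) [Decidable (inv s * s = t * inv t)] :
    composableMatrix y s t = if inv s * s = t * inv t then y (s * t) else 0 := by
  simp only [composableMatrix, Matrix.of_apply]
  congr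

/-- The multiplication table of `S` in terms of that of the groupoid. -/
theorem of_mul_eq (y : S → ℂ) :
    (Matrix.of fun s t => (moebiusEquiv S).symm y (s * t)) =
      zetaMatrix S * composableMatrix y * (zetaMatrix S).transpose := by
  classical
  ext s t
  -- The entry at `(s, t)` pairs `y` with `lower s * lower t`. Here the coefficient of the arrow `w`
  -- of the second factor is isolated, and `u = v w` is substituted.
  have hw (w : S) : ∑ u, leftMatrix (lower s).coeff u w * y u =
      (zetaMatrix S * composableMatrix y) s w := by
    have h₁ : ∑ u, leftMatrix (lower s).coeff u w * y u =
        ∑ u : S with inv u * u = inv w * w, (lower s).coeff (u * inv w) * y u := by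
      rw [Finset.sum_filter]
      refine Finset.sum_congr rfl fun u _ => ?_
      rw [leftMatrix_apply]
      split_ifs <;> simp
    have h₂ : (zetaMatrix S * composableMatrix y) s w =
        ∑ v : S with inv v * v = w * inv w, (lower s).coeff v * y (v * w) := by
      rw [Finset.sum_filter, Matrix.mul_apply]
      refine Finset.sum_congr rfl fun u _ => ?_
      rw [composableMatrix_apply, zetaMatrix_apply]
      split_ifs <;> simp
    rw [h₁, h₂]
    refine Finset.sum_nbij' (fun v => v * inv w) (fun v => v * w) ?_ ?_ ?_ ?_ ?_
    · intro v hv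
      simp only [Finset.mem_filter, Finset.mem_univ, true_and] at hv ⊢
      exact dom_mul_inv hv
    · intro v hv
      simp only [Finset.mem_filter, Finset.mem_univ, true_and] at hv ⊢
      exact dom_mul hv
    · intro v hv
      simp only [Finset.mem_filter, Finset.mem_univ, true_and] at hv
      rw [mul_assoc, ← hv, mul_dom]
    · intro v hv
      simp only [Finset.mem_filter, Finset.mem_univ, true_and] at hv
      rw [mul_assoc, ← hv, mul_dom]
    · intro v hv
      simp only [Finset.mem_filter, Finset.mem_univ, true_and] at hv
      rw [mul_assoc v, ← hv, mul_dom]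
  rw [Matrix.mul_apply, Matrix.of_apply, moebiusEquiv_symm_apply, Matrix.mulVec, dotProduct]
  simp only [← hw, zetaMatrix_apply, ← lower_mul, coeff_mul, Matrix.mulVec, dotProduct,
    Matrix.transpose_apply, Finset.sum_mul]
  rw [Finset.sum_comm]
  exact Finset.sum_congr rfl fun w _ => Finset.sum_congr rfl fun u _ => by ring

theorem det_of_mul [DecidableEq S] (x : S → ℂ) :
    (Matrix.of fun s t => x (s * t)).det = (composableMatrix (moebiusEquiv S x)).det := by
  have h := congrArg Matrix.det (of_mul_eq (moebiusEquiv S x))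
  rw [LinearEquiv.symm_apply_apply, Matrix.det_mul, Matrix.det_mul, Matrix.det_transpose,
    mul_right_comm, det_zetaMatrix_sq, one_mul] at h
  exact h

open Classical in
theorem eval_semigroupDet (x : S → ℂ) :
    MvPolynomial.eval x (semigroupDet S) = (composableMatrix (moebiusEquiv S x)).det := by
  rw [← det_of_mul, semigroupDet]
  refine (RingHom.map_det _ _).trans ?_
  congr 1
  ext s t
  simp

open CategoryTheory

omit [Fintype S] in
theorem arrowElem_comp (a b : Arrow (UnderlyingGroupoid S)) (h : b.right = a.left) :
    arrowElem (Arrow.mk (b.hom ≫ eqToHom h ≫ a.hom)) = arrowElem a * arrowElem b := by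
  obtain ⟨e, f, φ⟩ := a
  obtain ⟨e', f', ψ⟩ := b
  change f' = e at h
  subst h
  simp only [eqToHom_refl, Category.id_comp]
  rfl

omit [Fintype S] in
theorem right_eq_left_iff (a b : Arrow (UnderlyingGroupoid S)) :
    b.right = a.left ↔
      inv (arrowElem a) * arrowElem a = arrowElem b * inv (arrowElem b) := by
  have h₁ : inv (arrowElem a) * arrowElem a = a.left.val := UnderlyingGroupoid.Hom.dom a.hom
  have h₂ : arrowElem b * inv (arrowElem b) = b.right.val := UnderlyingGroupoid.Hom.ran b.hom
  rw [h₁, h₂]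
  constructor
  · intro h
    rw [h]
  · intro h
    cases hb : b.right
    cases ha : a.left
    simp only [ha, hb] at h
    subst h
    rfl

theorem semigroupDet_eq_categoryDet :
    semigroupDet S = MvPolynomial.aeval (fun a => yForm (arrowElem a))
      (categoryDet (UnderlyingGroupoid S)) := by
  classical
  -- Over the infinite field `ℂ` it suffices to compare values, where the numerical matrix identity
  -- applies.
  refine MvPolynomial.funext fun x => ?_
  rw [eval_semigroupDet, categoryDet, AlgHom.map_det, RingHom.map_det,
    ← Matrix.det_submatrix_equiv_self (Equiv.ofBijective _ (arrowElem_bijective (S := S)))]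
  congr!
  ext a b
  simp only [Matrix.submatrix_apply, Equiv.ofBijective_apply, composableMatrix_apply,
    AlgHom.mapMatrix_apply, RingHom.mapMatrix_apply, Matrix.map_apply, Matrix.of_apply]
  by_cases h : b.right = a.left
  · rw [dif_pos h, if_pos ((right_eq_left_iff a b).1 h), MvPolynomial.aeval_X, eval_yForm,
      arrowElem_comp]
  · rw [dif_neg h, if_neg (mt (right_eq_left_iff a b).2 h), map_zero, map_zero]

/-- The determinant of the groupoid is, up to sign, that of a left multiplication. -/
theorem det_composableMatrix [DecidableEq S] : ∃ ε : ℂ, ε ≠ 0 ∧ (IsEmpty S → ε = 1) ∧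
    ∀ y : S → ℂ, (composableMatrix y).det = ε * (leftMatrix y).det := by
  classical
  let σ : Equiv.Perm S := Equiv.ofBijective inv inv_bijective
  -- The constant is the sign of `s ↦ s*`. The empty case is recorded because there no factor exists
  -- to absorb a constant.
  refine ⟨((Equiv.Perm.sign σ : ℤ) : ℂ), ?_, ?_, fun y => ?_⟩
  · exact_mod_cast (Equiv.Perm.sign σ).ne_zero
  · intro h
    rw [Subsingleton.elim σ 1]
    simp
  · rw [← Matrix.det_permute']
    congr!
    ext u w
    rw [Matrix.submatrix_apply, composableMatrix_apply, leftMatrix_apply]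
    change _ = if inv u * u = inv (inv w) * inv w then y (u * inv (inv w)) else 0
    rw [InverseSemigroup.inv_inv]

theorem det_leftMatrix [DecidableEq S] (f : GroupoidAlgebra S) :
    (leftMatrix f.coeff).det = Algebra.norm ℂ f := by
  rw [← LinearMap.det_toLin', Algebra.norm_apply, ← LinearMap.det_conj _ (coeffₗ S)]
  congr 1

end

end GroupoidAlgebra

/-! ### Irreducible representations and their number. -/

namespace GroupoidAlgebra

noncomputable section

variable {S : Type*} [Semigroup S] [IsInverseSemigroup S] [Fintype S]

open Classical in
/-- The coordinates of a function on `S` with respect to the functions `t ↦ [t ≤ s]`. -/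
def lowerCoordinates (S : Type*) [Semigroup S] [IsInverseSemigroup S] [Fintype S] :
    (S → ℂ) ≃ₗ[ℂ] (S → ℂ) :=
  LinearEquiv.ofLinearMap (moebiusMatrix S).transpose.toLin' (zetaMatrix S).transpose.toLin'
    (by rw [← Matrix.toLin'_mul, ← Matrix.transpose_mul, zetaMatrix_mul_moebiusMatrix,
      Matrix.transpose_one, Matrix.toLin'_one])
    (by rw [← Matrix.toLin'_mul, ← Matrix.transpose_mul, moebiusMatrix_mul_zetaMatrix,
      Matrix.transpose_one, Matrix.toLin'_one])

/-- The images of the elements of `S` form a basis of the groupoid algebra. -/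
def lowerBasis (S : Type*) [Semigroup S] [IsInverseSemigroup S] [Fintype S] :
    Module.Basis S ℂ (GroupoidAlgebra S) :=
  Module.Basis.ofEquivFun ((coeffₗ S).trans (lowerCoordinates S))

theorem lowerBasis_apply (s : S) : lowerBasis S s = lower s := by
  classical
  rw [lowerBasis, Module.Basis.coe_ofEquivFun]
  ext t
  change (zetaMatrix S).transpose.toLin' (Pi.single s 1) t = _
  rw [Matrix.toLin'_apply, Matrix.mulVec_single_one]
  rfl

section Lift

variable {A : Type*} [Ring A] [Algebra ℂ A] (ρ : S →ₙ* A)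

/-- The linear extension of a homomorphism on `S` to the groupoid algebra. -/
def lift : GroupoidAlgebra S →ₗ[ℂ] A := (lowerBasis S).constr ℂ ρ

theorem lift_lower (s : S) : lift ρ (lower s) = ρ s := by
  rw [lift, ← lowerBasis_apply, Module.Basis.constr_basis]

theorem lift_mul (f g : GroupoidAlgebra S) : lift ρ (f * g) = lift ρ f * lift ρ g := by
  have : (LinearMap.mul ℂ (GroupoidAlgebra S)).compr₂ (lift ρ) =
      (LinearMap.mul ℂ A).compl₁₂ (lift ρ) (lift ρ) := by
    refine (lowerBasis S).ext fun s => (lowerBasis S).ext fun t => ?_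
    simp only [LinearMap.compr₂_apply, LinearMap.mul_apply', LinearMap.compl₁₂_apply,
      lowerBasis_apply, lower_mul, lift_lower, map_mul]
  exact LinearMap.congr_fun₂ this f g

end Lift

/-- The linear extension is not unital by construction. The image of `1` is a two-sided identity for
all `σ t`, so its range is invariant; the range cannot be zero since `σ ≠ 0`, hence it is
everything. -/
theorem lift_one_of_irreducible {m : ℕ} {σ : S →ₙ* Matrix (Fin m) (Fin m) ℂ}
    (hσ : IsIrreducibleRep σ) : lift σ 1 = 1 := by
  obtain ⟨⟨s, hs⟩, hW⟩ := hσ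
  have hone (t : S) : lift σ 1 * σ t = σ t ∧ σ t * lift σ 1 = σ t := by
    rw [← lift_lower, ← lift_mul, ← lift_mul, one_mul, mul_one]
    exact ⟨rfl, rfl⟩
  have hinv (t : S) : ∀ w ∈ LinearMap.range (lift σ 1).toLin',
      (σ t).mulVec w ∈ LinearMap.range (lift σ 1).toLin' := by
    rintro _ ⟨w, rfl⟩
    refine ⟨(σ t).mulVec w, ?_⟩
    rw [Matrix.toLin'_apply, Matrix.toLin'_apply, Matrix.mulVec_mulVec, Matrix.mulVec_mulVec,
      (hone t).1, (hone t).2]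
  rcases hW _ hinv with h | h
  · exfalso
    apply hs
    rw [LinearMap.range_eq_bot, LinearEquiv.map_eq_zero_iff] at h
    rw [← (hone s).1, h, zero_mul]
  · apply Matrix.toLin'.injective
    apply LinearMap.ext
    intro v
    obtain ⟨w, rfl⟩ : v ∈ LinearMap.range (lift σ 1).toLin' := h ▸ Submodule.mem_top
    rw [Matrix.toLin'_apply, Matrix.toLin'_apply, Matrix.mulVec_mulVec, ← lift_mul, one_mul,
      Matrix.toLin'_one]
    rfl

section Wedderburn

variable {n : ℕ} {d : Fin n → ℕ}
  (e : GroupoidAlgebra S ≃ₐ[ℂ] Π i, Matrix (Fin (d i)) (Fin (d i)) ℂ)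

/-- The representation of `S` on a factor of its groupoid algebra. -/
def factorRep (i : Fin n) : S →ₙ* Matrix (Fin (d i)) (Fin (d i)) ℂ where
  toFun s := e (lower s) i
  map_mul' s t := by rw [← lower_mul, map_mul, Pi.mul_apply]

/-- A linear property of all elements of a factor can be checked on the image of `S`. -/
theorem factor_induction (i : Fin n) {p : Matrix (Fin (d i)) (Fin (d i)) ℂ → Prop}
    (h : ∀ s, p (factorRep e i s)) (h0 : p 0) (hadd : ∀ M N, p M → p N → p (M + N))
    (hsmul : ∀ (c : ℂ) M, p M → p (c • M)) (f : GroupoidAlgebra S) : p (e f i) := by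
  have hf : f ∈ Submodule.span ℂ (Set.range (lowerBasis S)) := by
    rw [(lowerBasis S).span_eq]
    trivial
  induction hf using Submodule.span_induction with
  | mem x hx =>
    obtain ⟨s, rfl⟩ := hx
    rw [lowerBasis_apply]
    exact h s
  | zero => simpa using h0
  | add x y _ _ hx hy => simpa using hadd _ _ hx hy
  | smul c x _ hx => simpa using hsmul c _ hx

theorem factorRep_irreducible (i : Fin n) [NeZero (d i)] : IsIrreducibleRep (factorRep e i) := by
  classical
  constructor
  · by_contra! h
    have : e 1 i = 0 := factor_induction e i (p := fun M => M = 0) h rfl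
      (by rintro M N rfl rfl; simp) (by rintro c M rfl; simp) 1
    rw [map_one, Pi.one_apply] at this
    exact one_ne_zero this
  · intro W hW
    rw [or_iff_not_imp_left]
    intro hbot
    obtain ⟨w, hw, hw0⟩ := Submodule.exists_mem_ne_zero_of_ne_bot hbot
    obtain ⟨k, hk⟩ := Function.ne_iff.1 hw0
    rw [Pi.zero_apply] at hk
    rw [eq_top_iff]
    intro v _
    -- The image of `S` spans the whole matrix algebra, so `W` is stable under the rank-one matrix
    -- sending `w` to `v`.
    have key := factor_induction e i (p := fun M => ∀ w ∈ W, M.mulVec w ∈ W) hW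
      (fun w _ => by simp)
      (fun M N hM hN w hw => by rw [Matrix.add_mulVec]; exact W.add_mem (hM w hw) (hN w hw))
      (fun c M hM w hw => by rw [Matrix.smul_mulVec]; exact W.smul_mem c (hM w hw))
      (e.symm (Pi.single i (Matrix.vecMulVec v (Pi.single k (w k)⁻¹)))) w hw
    rw [AlgEquiv.apply_symm_apply, Pi.single_eq_same] at key
    convert key
    ext a
    simp [Matrix.mulVec, dotProduct, Matrix.vecMulVec_apply, Pi.single_apply, mul_assoc, hk]

/-- An equivalence would intertwine the actions of the whole algebra, but the central idempotent of
factor `i` acts as `1` on one side and as `0` on the other. -/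
theorem factorRep_not_equiv [∀ i, NeZero (d i)] {i j : Fin n} (hij : i ≠ j) :
    ¬ RepEquiv (factorRep e i) (factorRep e j) := by
  classical
  rintro ⟨T, hT⟩
  have key (f : GroupoidAlgebra S) : ∀ v, T ((e f i).mulVec v) = (e f j).mulVec (T v) := by
    have hf : f ∈ Submodule.span ℂ (Set.range (lowerBasis S)) := by
      rw [(lowerBasis S).span_eq]
      trivial
    induction hf using Submodule.span_induction with
    | mem x hx =>
      obtain ⟨s, rfl⟩ := hx
      rw [lowerBasis_apply]
      exact hT s
    | zero => simp
    | add x y _ _ hx hy => simp [Matrix.add_mulVec, hx, hy]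
    | smul c x _ hx => simp [Matrix.smul_mulVec, hx]
  have h := key (e.symm (Pi.single i 1)) 1
  rw [AlgEquiv.apply_symm_apply, Pi.single_eq_same, Pi.single_eq_of_ne hij.symm,
    Matrix.one_mulVec, Matrix.zero_mulVec, LinearEquiv.map_eq_zero_iff] at h
  exact one_ne_zero (congrFun h 0)

/-- A Schur argument. Some diagonal matrix unit `E_kk` of some factor `i` acts nontrivially on a
vector `v`; then `u ↦ φ(u e_kᵀ) v` is a nonzero intertwiner, bijective because both sides are
irreducible. -/
theorem exists_repEquiv_factorRep [∀ i, NeZero (d i)] {m : ℕ}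
    (σ : S →ₙ* Matrix (Fin m) (Fin m) ℂ) (hσ : IsIrreducibleRep σ) :
    ∃ i, RepEquiv σ (factorRep e i) := by
  classical
  let φ : (Π i, Matrix (Fin (d i)) (Fin (d i)) ℂ) →ₗ[ℂ] Matrix (Fin m) (Fin m) ℂ :=
    (lift σ).comp e.symm.toLinearMap
  have hφ (M) : φ M = lift σ (e.symm M) := rfl
  have hmul (M N) : φ (M * N) = φ M * φ N := by rw [hφ, map_mul, lift_mul]; rfl
  have hone : φ 1 = 1 := by rw [hφ, map_one, lift_one_of_irreducible hσ]
  have hne : φ 1 ≠ 0 := by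
    intro h
    obtain ⟨s, hs⟩ := hσ.1
    rw [hone] at h
    exact hs (by rw [← one_mul (σ s), h, zero_mul])
  obtain ⟨i, hi⟩ : ∃ i, φ (Pi.single i 1) ≠ 0 := by
    by_contra! h
    apply hne
    rw [← Finset.univ_sum_single (1 : Π i, Matrix (Fin (d i)) (Fin (d i)) ℂ), map_sum]
    exact Finset.sum_eq_zero fun i _ => h i
  obtain ⟨k, hk⟩ : ∃ k, φ (Pi.single i
      (Matrix.vecMulVec (Pi.single k 1) (Pi.single k 1))) ≠ 0 := by
    by_contra! h
    apply hi
    have : (1 : Matrix (Fin (d i)) (Fin (d i)) ℂ) =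
        ∑ k, Matrix.vecMulVec (Pi.single k 1) (Pi.single k 1) := by
      ext a b
      simp [Matrix.sum_apply, Matrix.vecMulVec_apply, Pi.single_apply, Matrix.one_apply]
    rw [this]
    have hs := map_sum (φ.comp (LinearMap.single ℂ
      (fun i => Matrix (Fin (d i)) (Fin (d i)) ℂ) i))
      (fun k => Matrix.vecMulVec (Pi.single k 1) (Pi.single k 1)) Finset.univ
    exact hs.trans (Finset.sum_eq_zero fun k _ => h k)
  obtain ⟨v, hv⟩ : ∃ v, (φ (Pi.single i
      (Matrix.vecMulVec (Pi.single k 1) (Pi.single k 1)))).mulVec v ≠ 0 := by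
    by_contra! h
    exact hk (Matrix.ext_of_mulVec_single fun j => by rw [h, Matrix.zero_mulVec])
  let T : (Fin (d i) → ℂ) →ₗ[ℂ] (Fin m → ℂ) :=
    { toFun := fun u => (φ (Pi.single i (Matrix.vecMulVec u (Pi.single k 1)))).mulVec v
      map_add' := fun a b => by
        rw [Matrix.add_vecMulVec, Pi.single_add, map_add, Matrix.add_mulVec]
      map_smul' := fun c a => by
        rw [Matrix.smul_vecMulVec, Pi.single_smul, map_smul, Matrix.smul_mulVec]
        rfl }
  have hT (s : S) (u) : T ((factorRep e i s).mulVec u) = (σ s).mulVec (T u) := by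
    change (φ _).mulVec v = (σ s).mulVec ((φ _).mulVec v)
    rw [Matrix.mulVec_mulVec, ← lift_lower σ s, ← e.symm_apply_apply (lower s), ← hφ, ← hmul]
    congr 2
    rw [← Matrix.mul_vecMulVec]
    funext j
    by_cases hj : j = i
    · subst hj
      rw [Pi.mul_apply, Pi.single_eq_same, Pi.single_eq_same]
      rfl
    · rw [Pi.mul_apply, Pi.single_eq_of_ne hj, Pi.single_eq_of_ne hj, mul_zero]
  have hTk : T (Pi.single k 1) ≠ 0 := hv
  have hker : LinearMap.ker T = ⊥ := by
    refine ((factorRep_irreducible e i).2 (LinearMap.ker T) ?_).resolve_right ?_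
    · intro s w hw
      rw [LinearMap.mem_ker] at hw ⊢
      rw [hT, hw, Matrix.mulVec_zero]
    · intro h
      exact hTk (LinearMap.mem_ker.1 (h ▸ Submodule.mem_top))
  have hrange : LinearMap.range T = ⊤ := by
    refine (hσ.2 (LinearMap.range T) ?_).resolve_left ?_
    · rintro s _ ⟨w, rfl⟩
      exact ⟨_, hT s w⟩
    · intro h
      rw [LinearMap.range_eq_bot] at h
      exact hTk (by rw [h]; rfl)
  let T' := LinearEquiv.ofBijective T ⟨LinearMap.ker_eq_bot.1 hker, LinearMap.range_eq_top.1 hrange⟩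
  refine ⟨i, T'.symm, fun s w => ?_⟩
  rw [LinearEquiv.symm_apply_eq]
  have h := hT s (T'.symm w)
  have h2 : T (T'.symm w) = w := T'.apply_symm_apply w
  rw [h2] at h
  exact h.symm

end Wedderburn

/-- A linear functional on matrices that is invariant under cyclic permutation is a multiple of the
trace. -/
theorem exists_eq_mul_trace {m : ℕ} [NeZero m] (τ : Matrix (Fin m) (Fin m) ℂ →ₗ[ℂ] ℂ)
    (h : ∀ M N, τ (M * N) = τ (N * M)) : ∃ c : ℂ, ∀ M, τ M = c * M.trace := by
  -- Write `E_ij = E_i0 E_0j`; the reversed product is `E_00` if `i = j` and `0` otherwise.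
  refine ⟨τ (Matrix.single 0 0 1), fun M => ?_⟩
  have hs (i j : Fin m) : τ (Matrix.single i j 1) = if i = j then τ (Matrix.single 0 0 1) else 0 := by
    have h1 := h (Matrix.single i 0 1) (Matrix.single 0 j 1)
    rw [Matrix.single_mul_single_same, one_mul] at h1
    rw [h1]
    split_ifs with hij
    · subst hij
      rw [Matrix.single_mul_single_same, one_mul]
    · rw [Matrix.single_mul_single_of_ne _ _ _ _ (Ne.symm hij), map_zero]
  conv_lhs => rw [Matrix.matrix_eq_sum_single M]
  simp only [map_sum]
  have (i j : Fin m) : τ (Matrix.single i j (M i j)) =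
      if i = j then M i j * τ (Matrix.single 0 0 1) else 0 := by
    have : Matrix.single i j (M i j) = M i j • Matrix.single i j (1 : ℂ) := by
      rw [Matrix.smul_single, smul_eq_mul, mul_one]
    rw [this, map_smul, hs, smul_eq_mul, mul_ite, mul_zero]
  simp [this, Matrix.trace, Finset.sum_mul, mul_comm]

/-- Functions on the conjugacy classes, as functionals on the groupoid algebra. -/
def classFunctional (S : Type*) [Semigroup S] [IsInverseSemigroup S] [Fintype S] :
    (Quotient (conjSetoid S) → ℂ) →ₗ[ℂ] (GroupoidAlgebra S →ₗ[ℂ] ℂ) :=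
  ((lowerBasis S).constr ℂ).toLinearMap.comp (LinearMap.funLeft ℂ ℂ (Quotient.mk _))

theorem classFunctional_lower (c : Quotient (conjSetoid S) → ℂ) (s : S) :
    classFunctional S c (lower s) = c (Quotient.mk _ s) := by
  rw [← lowerBasis_apply]
  exact (lowerBasis S).constr_basis ℂ _ s

theorem classFunctional_injective : Function.Injective (classFunctional S) := by
  intro c c' h
  funext q
  induction q using Quotient.ind with
  | _ s => rw [← classFunctional_lower c, ← classFunctional_lower c', h]

/-- On the basis `lower s`, which multiplies as `S` does, invariance under `fg ↦ gf` says precisely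
that values agree on `ab` and `ba`. -/
theorem mem_range_classFunctional (τ : GroupoidAlgebra S →ₗ[ℂ] ℂ) :
    τ ∈ LinearMap.range (classFunctional S) ↔ ∀ f g, τ (f * g) = τ (g * f) := by
  constructor
  · rintro ⟨c, rfl⟩ f g
    have : (LinearMap.mul ℂ (GroupoidAlgebra S)).compr₂ (classFunctional S c) =
        (LinearMap.mul ℂ (GroupoidAlgebra S)).flip.compr₂ (classFunctional S c) := by
      refine (lowerBasis S).ext fun s => (lowerBasis S).ext fun t => ?_
      simp only [LinearMap.compr₂_apply, LinearMap.mul_apply', LinearMap.flip_apply,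
        lowerBasis_apply, lower_mul, classFunctional_lower]
      exact congrArg c (Quotient.sound (Relation.EqvGen.rel _ _ ⟨s, t, rfl, rfl⟩))
    exact LinearMap.congr_fun₂ this f g
  · intro h
    have hc (s t : S) (hst : Relation.EqvGen (fun x y => ∃ a b : S, x = a * b ∧ y = b * a) s t) :
        τ (lower s) = τ (lower t) := by
      induction hst with
      | rel x y hxy =>
        obtain ⟨a, b, rfl, rfl⟩ := hxy
        rw [← lower_mul, ← lower_mul, h]
      | refl x => rfl
      | symm x y _ ih => exact ih.symm
      | trans x y z _ _ ih ih' => exact ih.trans ih'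
    refine ⟨Quotient.lift (fun s => τ (lower s)) hc, (lowerBasis S).ext fun s => ?_⟩
    rw [lowerBasis_apply, classFunctional_lower]
    rfl

section Count

variable {n : ℕ} {d : Fin n → ℕ}
  (e : GroupoidAlgebra S ≃ₐ[ℂ] Π i, Matrix (Fin (d i)) (Fin (d i)) ℂ)

/-- Linear combinations of the irreducible characters, as functionals on the groupoid algebra. -/
def characterFunctional : (Fin n → ℂ) →ₗ[ℂ] (GroupoidAlgebra S →ₗ[ℂ] ℂ) :=
  Fintype.linearCombination ℂ fun i =>
    (Matrix.traceLinearMap (Fin (d i)) ℂ ℂ).comp ((LinearMap.proj i).comp e.toLinearMap)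

theorem characterFunctional_apply (c : Fin n → ℂ) (f : GroupoidAlgebra S) :
    characterFunctional e c f = ∑ i, c i * (e f i).trace := by
  simp [characterFunctional, Fintype.linearCombination_apply]

theorem characterFunctional_injective [∀ i, NeZero (d i)] :
    Function.Injective (characterFunctional e) := by
  classical
  rw [injective_iff_map_eq_zero]
  intro c hc
  funext i
  have h := LinearMap.congr_fun hc (e.symm (Pi.single i 1))
  rw [characterFunctional_apply, AlgEquiv.apply_symm_apply, Finset.sum_eq_single i] at h
  · rw [Pi.single_eq_same, Matrix.trace_one, Fintype.card_fin] at h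
    simpa [NeZero.ne] using h
  · intro j _ hj
    rw [Pi.single_eq_of_ne hj, Matrix.trace_zero, mul_zero]
  · simp

theorem mem_range_characterFunctional [∀ i, NeZero (d i)] (τ : GroupoidAlgebra S →ₗ[ℂ] ℂ) :
    τ ∈ LinearMap.range (characterFunctional e) ↔ ∀ f g, τ (f * g) = τ (g * f) := by
  classical
  constructor
  · rintro ⟨c, rfl⟩ f g
    simp only [characterFunctional_apply, map_mul, Pi.mul_apply]
    exact Finset.sum_congr rfl fun i _ => by rw [Matrix.trace_mul_comm]
  · intro h
    let single (i : Fin n) := LinearMap.single ℂ (fun i => Matrix (Fin (d i)) (Fin (d i)) ℂ) i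
    have hc (i : Fin n) := exists_eq_mul_trace
      ((τ.comp e.symm.toLinearMap).comp (single i)) (by
        intro M N
        change τ (e.symm (Pi.single i (M * N))) = τ (e.symm (Pi.single i (N * M)))
        rw [Pi.single_mul, Pi.single_mul, map_mul e.symm, map_mul e.symm, h])
    choose c hc using hc
    refine ⟨c, LinearMap.ext fun f => ?_⟩
    rw [characterFunctional_apply]
    conv_rhs => rw [← e.symm_apply_apply f, ← Finset.univ_sum_single (e f), map_sum, map_sum]
    exact Finset.sum_congr rfl fun i _ => (hc i (e f i)).symm

/-- The number of simple factors is the number of conjugacy classes. -/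
theorem card_factors [∀ i, NeZero (d i)]
    (e : GroupoidAlgebra S ≃ₐ[ℂ] Π i, Matrix (Fin (d i)) (Fin (d i)) ℂ) : n = numConjClasses S := by
  have : Fintype (Quotient (conjSetoid S)) := Fintype.ofFinite _
  have h₁ := LinearMap.finrank_range_of_inj (classFunctional_injective (S := S))
  have h₂ := LinearMap.finrank_range_of_inj (characterFunctional_injective e)
  -- Both families parametrize the functionals with `τ(fg) = τ(gf)`, so their dimensions agree.
  have h : LinearMap.range (classFunctional S) = LinearMap.range (characterFunctional e) := by
    ext τ
    rw [mem_range_classFunctional, mem_range_characterFunctional]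
  rw [h, h₂, Module.finrank_fin_fun, Module.finrank_fintype_fun_eq_card] at h₁
  rw [numConjClasses, Nat.card_eq_fintype_card, h₁]

end Count

end

end GroupoidAlgebra

/-! ### Irreducibility of the generic determinant. -/

namespace Matrix
open MvPolynomial

variable {σ K : Type*} [Field K]

/-- The determinant of a square matrix of distinct variables. -/
noncomputable def genericDet (K : Type*) [Field K] {n : ℕ} (m : Fin n → Fin n → σ) :
    MvPolynomial σ K :=
  det (of fun a b => X (m a b))

theorem eval_genericDet {n : ℕ} (m : Fin n → Fin n → σ) (p : σ → K) :
    eval p (genericDet K m) = det (of fun a b => p (m a b)) := by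
  rw [genericDet, RingHom.map_det]
  congr 1
  ext a b
  simp

theorem exists_eval_genericDet_eq {n : ℕ} {m : Fin n → Fin n → σ}
    (hm : Function.Injective fun q : Fin n × Fin n => m q.1 q.2) (A : Matrix (Fin n) (Fin n) K) :
    ∃ p : σ → K, ∀ a b, p (m a b) = A a b :=
  ⟨Function.extend (fun q : Fin n × Fin n => m q.1 q.2) (fun q => A q.1 q.2) 0,
    fun a b => hm.extend_apply (fun q : Fin n × Fin n => A q.1 q.2) 0 (a, b)⟩

theorem genericDet_isHomogeneous {n : ℕ} (m : Fin n → Fin n → σ) :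
    (genericDet K m).IsHomogeneous n := by
  rw [genericDet, det_apply]
  refine IsHomogeneous.sum _ _ _ fun τ _ => ?_
  have h : (∏ i, (of fun a b => (X (m a b) : MvPolynomial σ K)) (τ i) i).IsHomogeneous n := by
    simpa using IsHomogeneous.prod Finset.univ
      (fun i => (of fun a b => (X (m a b) : MvPolynomial σ K)) (τ i) i) (fun _ => 1)
      (fun i _ => isHomogeneous_X _ _)
  rcases Int.units_eq_one_or (Equiv.Perm.sign τ) with hs | hs
  · rw [hs, one_smul]
    exact h
  · rw [hs, Units.neg_smul, one_smul]
    exact h.neg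

theorem det_mem_supported {n : ℕ} (s : Set σ) (A : Matrix (Fin n) (Fin n) (MvPolynomial σ K))
    (hA : ∀ a b, A a b ∈ supported K s) : A.det ∈ supported K s := by
  rw [det_apply']
  refine Subalgebra.sum_mem _ fun τ _ => Subalgebra.mul_mem _ (intCast_mem _ _) ?_
  exact Subalgebra.prod_mem _ fun i _ => hA _ _

/-- The determinant of a matrix of distinct variables is irreducible. -/
theorem irreducible_genericDet {n : ℕ} (hn : n ≠ 0) (m : Fin n → Fin n → σ)
    (hm : Function.Injective fun q : Fin n × Fin n => m q.1 q.2) :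
    Irreducible (genericDet K m) := by
  induction n with
  | zero => exact absurd rfl hn
  | succ n ih =>
    have hm' {a b a' b'} (h : m a b = m a' b') : a = a' ∧ b = b' := by
      simpa using @hm (a, b) (a', b') h
    rcases Nat.eq_zero_or_pos n with rfl | hpos
    · have : genericDet K m = X (m 0 0) := by simp [genericDet]
      rw [this]
      exact X_prime.irreducible
    · have hminj : Function.Injective
          fun q : Fin n × Fin n => m q.1.succ q.2.succ := by
        rintro ⟨a, b⟩ ⟨a', b'⟩ h
        simpa using hm' h
      have hirr := ih hpos.ne' (fun a b => m a.succ b.succ) hminj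
      set f := genericDet K fun a b : Fin n => m a.succ b.succ with hf
      set A : Matrix (Fin (n + 1)) (Fin (n + 1)) (MvPolynomial σ K) := of fun a b => X (m a b)
        with hA
      set g := ∑ j : Fin n, (-1) ^ ((j.succ : Fin (n + 1)) : ℕ) * A 0 j.succ *
        (A.submatrix Fin.succ j.succ.succAbove).det with hg
      -- The determinant has degree one in the corner variable, and its coefficient `f` is
      -- irreducible by induction. Irreducibility thus reduces to `f ∤ g`.
      have hdet : genericDet K m = f * X (m 0 0) + g := by
        rw [genericDet, ← hA, det_succ_row_zero, Fin.sum_univ_succ, ← hg]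
        congr 1
        simp only [Fin.val_zero, pow_zero, one_mul, Fin.succAbove_zero]
        rw [mul_comm]
        rfl
      have hX {a b} (h : ¬(a = 0 ∧ b = 0)) : A a b ∈ supported K {m 0 0}ᶜ := by
        rw [hA, of_apply, X_mem_supported]
        intro h'
        exact h (hm' h')
      have hfs : f ∈ supported K {m 0 0}ᶜ :=
        det_mem_supported _ _ fun a b => hX (by simp)
      have hgs : g ∈ supported K {m 0 0}ᶜ := by
        refine Subalgebra.sum_mem _ fun j _ => Subalgebra.mul_mem _ (Subalgebra.mul_mem _ ?_ ?_) ?_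
        · exact Subalgebra.pow_mem _ (Subalgebra.neg_mem _ (Subalgebra.one_mem _)) _
        · exact hX (by simp)
        · exact det_mem_supported _ _ fun a b => hX (by simp)
      rw [hdet]
      refine irreducible_mul_X_add f g (m 0 0) hirr.ne_zero
        (fun h => (mem_supported.1 hfs h) rfl) (fun h => (mem_supported.1 hgs h) rfl) ?_
      rw [hirr.isRelPrime_iff_not_dvd]
      intro hdvd
      -- At the permutation matrix of the transposition `(0 1)`, the minor `f` has a zero row while
      -- the determinant is `-1`; if `f` divided `g`, both terms would vanish there.
      let c : Fin (n + 1) := Fin.succ ⟨0, hpos⟩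
      let P : Matrix (Fin (n + 1)) (Fin (n + 1)) K := (Equiv.swap 0 c).permMatrix K
      obtain ⟨p, hp⟩ := exists_eval_genericDet_eq hm P
      have hp0 : eval p f = 0 := by
        rw [hf, eval_genericDet]
        simp only [hp]
        refine det_eq_zero_of_row_eq_zero ⟨0, hpos⟩ fun b => ?_
        simp only [P, of_apply, Equiv.Perm.permMatrix, PEquiv.toMatrix_apply,
          Equiv.toPEquiv_apply, Option.mem_def, Option.some.injEq]
        change (if Equiv.swap 0 c c = b.succ then (1 : K) else 0) = 0
        rw [Equiv.swap_apply_right, if_neg (Fin.succ_ne_zero b).symm]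
      have hg0 : eval p g = 0 := by
        obtain ⟨q, hq⟩ := hdvd
        rw [hq, map_mul, hp0, zero_mul]
      have h := eval_genericDet m p
      rw [hdet, map_add, map_mul, hp0, hg0, zero_mul, add_zero] at h
      simp only [hp] at h
      have hP : P.det = -1 := by
        rw [det_permutation, Equiv.Perm.sign_swap (Fin.succ_ne_zero _).symm]
        simp
      have h' : (0 : K) = -1 := h.trans hP
      exact one_ne_zero (neg_eq_zero.1 h'.symm)

end Matrix

/-! ### Linear changes of variables. -/

namespace MvPolynomial

variable {σ τ : Type*} [Fintype σ]

open Classical in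
/-- The substitution of linear forms that corresponds to a linear map of affine spaces. -/
noncomputable def linearSubst (Φ : (σ → ℂ) →ₗ[ℂ] (τ → ℂ)) :
    MvPolynomial τ ℂ →ₐ[ℂ] MvPolynomial σ ℂ :=
  aeval fun j => ∑ s, C (Φ (Pi.single s 1) j) * X s

theorem apply_eq_sum_single [DecidableEq σ] (Φ : (σ → ℂ) →ₗ[ℂ] (τ → ℂ)) (x : σ → ℂ) (j : τ) :
    Φ x j = ∑ s, Φ (Pi.single s 1) j * x s := by
  conv_lhs => rw [pi_eq_sum_univ' x, map_sum]
  rw [Finset.sum_apply]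
  refine Finset.sum_congr rfl fun s _ => ?_
  rw [map_smul, Pi.smul_apply, smul_eq_mul, mul_comm]

theorem eval_linearSubst (Φ : (σ → ℂ) →ₗ[ℂ] (τ → ℂ)) (x : σ → ℂ) (p : MvPolynomial τ ℂ) :
    eval x (linearSubst Φ p) = eval (Φ x) p := by
  classical
  induction p using MvPolynomial.induction_on with
  | C a => rw [← algebraMap_eq, AlgHom.commutes, algebraMap_eq, algebraMap_eq, eval_C, eval_C]
  | add p q hp hq => rw [map_add, map_add, map_add, hp, hq]
  | mul_X p j hp =>
    rw [map_mul, map_mul, map_mul, hp, eval_X, linearSubst, aeval_X, apply_eq_sum_single]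
    congr 1
    rw [map_sum]
    refine Finset.sum_congr rfl fun s _ => ?_
    rw [map_mul, eval_C, eval_X]

theorem linearSubst_isHomogeneous (Φ : (σ → ℂ) →ₗ[ℂ] (τ → ℂ)) {p : MvPolynomial τ ℂ} {k : ℕ}
    (hp : p.IsHomogeneous k) : (linearSubst Φ p).IsHomogeneous k := by
  classical
  rw [← one_mul k]
  refine hp.aeval _ fun j => IsHomogeneous.sum _ _ _ fun s _ => ?_
  simpa using (isHomogeneous_C σ _).mul (isHomogeneous_X ℂ s)

/-- Substituting the inverse linear map undoes the substitution, so it is an isomorphism of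
polynomial algebras. -/
theorem irreducible_linearSubst [Fintype τ] (Φ : (σ → ℂ) ≃ₗ[ℂ] (τ → ℂ)) {p : MvPolynomial τ ℂ}
    (hp : Irreducible p) : Irreducible (linearSubst Φ.toLinearMap p) := by
  let E : MvPolynomial τ ℂ ≃ₐ[ℂ] MvPolynomial σ ℂ :=
    AlgEquiv.ofAlgHom (linearSubst Φ.toLinearMap) (linearSubst Φ.symm.toLinearMap)
      (AlgHom.ext fun q => MvPolynomial.funext fun x => by
        rw [AlgHom.comp_apply, eval_linearSubst, eval_linearSubst]
        simp)
      (AlgHom.ext fun q => MvPolynomial.funext fun x => by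
        rw [AlgHom.comp_apply, eval_linearSubst, eval_linearSubst]
        simp)
  exact (MulEquiv.irreducible_iff E).2 hp

-- By linearity, the point `A T - B` is carried to the matrix `T·1 - M`. This is the mechanism by
-- which a factor of the determinant recovers a character.
open Polynomial in
theorem aeval_linearSubst_genericDet (Φ : (σ → ℂ) →ₗ[ℂ] (τ → ℂ)) {k : ℕ}
    (m : Fin k → Fin k → τ) (A B : σ → ℂ) (M : Matrix (Fin k) (Fin k) ℂ)
    (hA : ∀ a b, Φ A (m a b) = (1 : Matrix (Fin k) (Fin k) ℂ) a b)
    (hB : ∀ a b, Φ B (m a b) = M a b) :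
    aeval (fun u => Polynomial.C (A u) * (Polynomial.X : ℂ[X]) - Polynomial.C (B u))
      (linearSubst Φ (Matrix.genericDet ℂ m)) = M.charpoly := by
  classical
  rw [Matrix.genericDet, AlgHom.map_det, AlgHom.map_det, Matrix.charpoly]
  congr 1
  ext1 a b
  have h : aeval (fun u => Polynomial.C (A u) * (Polynomial.X : ℂ[X]) - Polynomial.C (B u))
      (linearSubst Φ (X (m a b))) =
      Polynomial.C (Φ A (m a b)) * Polynomial.X - Polynomial.C (Φ B (m a b)) := by
    rw [linearSubst, aeval_X, map_sum, apply_eq_sum_single Φ A, apply_eq_sum_single Φ B, map_sum,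
      map_sum, Finset.sum_mul, ← Finset.sum_sub_distrib]
    refine Finset.sum_congr rfl fun s _ => ?_
    rw [map_mul, aeval_X, map_mul, map_mul, ← algebraMap_eq, AlgHom.commutes,
      Polynomial.algebraMap_eq, mul_sub, mul_assoc]
  simp only [AlgHom.mapMatrix_apply, Matrix.map_apply, Matrix.of_apply]
  rw [h, hA, hB, Matrix.charmatrix_apply, Matrix.one_apply, Matrix.diagonal_apply]
  split_ifs <;> simp

end MvPolynomial

/-! ### The norm on a product of matrix algebras. -/

section PiMatrix

variable {n : ℕ} {d : Fin n → ℕ}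

/-- The entries of a family of matrices. -/
def Matrix.piEntries (d : Fin n → ℕ) :
    (Π i, Matrix (Fin (d i)) (Fin (d i)) ℂ) ≃ₗ[ℂ] ((Σ i, Fin (d i) × Fin (d i)) → ℂ) where
  toFun N q := N q.1 q.2.1 q.2.2
  invFun x i := Matrix.of fun a b => x ⟨i, a, b⟩
  map_add' _ _ := rfl
  map_smul' _ _ := rfl
  left_inv _ := rfl
  right_inv _ := rfl

theorem Matrix.det_blockDiagonal_dependent {R : Type*} [CommRing R] {m : Fin n → Type*}
    [∀ i, Fintype (m i)] [∀ i, DecidableEq (m i)] (M : ∀ i, Matrix (m i) (m i) R) :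
    (Matrix.blockDiagonal' M).det = ∏ i, (M i).det := by
  rw [(Matrix.blockTriangular_blockDiagonal' M).det_fintype]
  refine Finset.prod_congr rfl fun i _ => ?_
  rw [← Matrix.det_submatrix_equiv_self (Equiv.sigmaSubtype (β := m) i).symm]
  congr 1
  ext a b
  exact Matrix.blockDiagonal'_apply_eq M i a b

theorem Matrix.piEntries_apply (N : Π i, Matrix (Fin (d i)) (Fin (d i)) ℂ) (i : Fin n)
    (a b : Fin (d i)) : Matrix.piEntries d N ⟨i, a, b⟩ = N i a b := rfl

/-- The norm of an element of a product of matrix algebras. -/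
theorem Matrix.norm_pi_matrix (N : Π i, Matrix (Fin (d i)) (Fin (d i)) ℂ) :
    Algebra.norm ℂ N = ∏ i, (N i).det ^ d i := by
  classical
  -- Left multiplication acts on each of the `d i` columns separately, so it has `d i` diagonal
  -- blocks equal to `N i`.
  have h : LinearMap.det (Matrix.toLin' (Matrix.blockDiagonal' fun i =>
      Matrix.blockDiagonal fun _ : Fin (d i) => N i)) = ∏ i, (N i).det ^ d i := by
    rw [LinearMap.det_toLin', Matrix.det_blockDiagonal_dependent]
    simp [Matrix.det_blockDiagonal]
  rw [← h, Algebra.norm_apply, ← LinearMap.det_conj _ (Matrix.piEntries d)]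
  congr 1
  refine LinearMap.ext fun x => ?_
  obtain ⟨M, rfl⟩ := (Matrix.piEntries d).surjective x
  funext ⟨i, a, b⟩
  rw [LinearMap.comp_apply, LinearMap.comp_apply, LinearEquiv.coe_coe, LinearEquiv.coe_coe,
    LinearEquiv.symm_apply_apply, Matrix.toLin'_apply, Matrix.mulVec, dotProduct,
    Fintype.sum_sigma, Finset.sum_eq_single i]
  · simp only [Matrix.blockDiagonal'_apply_eq, Matrix.blockDiagonal_apply,
      Fintype.sum_prod_type]
    simp [Matrix.piEntries_apply, Matrix.mul_apply]
  · intro j _ hj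
    exact Finset.sum_eq_zero fun q _ => by
      rw [Matrix.blockDiagonal'_apply_ne _ _ _ (Ne.symm hj), zero_mul]
  · simp

end PiMatrix

/-! ### Factorization and specialization of the semigroup determinant. -/

namespace GroupoidAlgebra

noncomputable section

variable {S : Type*} [Semigroup S] [IsInverseSemigroup S] [Fintype S]

section Wedderburn

variable {n : ℕ} {d : Fin n → ℕ}
  (e : GroupoidAlgebra S ≃ₐ[ℂ] Π i, Matrix (Fin (d i)) (Fin (d i)) ℂ)

/-- The linear change of variables from the `x_s` to the entries of the matrices in the Wedderburn
decomposition of `∑ s, y_s s`. -/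
def entriesEquiv : (S → ℂ) ≃ₗ[ℂ] ((Σ i, Fin (d i) × Fin (d i)) → ℂ) :=
  (moebiusEquiv S).trans ((coeffₗ S).symm.trans (e.toLinearEquiv.trans (Matrix.piEntries d)))

theorem entriesEquiv_apply (x : S → ℂ) (i : Fin n) (a b : Fin (d i)) :
    entriesEquiv e x ⟨i, a, b⟩ = e ((coeffₗ S).symm (moebiusEquiv S x)) i a b := rfl

/-- The irreducible factor of the semigroup determinant attached to a factor of the algebra. -/
def factorPoly (i : Fin n) : MvPolynomial S ℂ :=
  MvPolynomial.linearSubst (entriesEquiv e).toLinearMap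
    (Matrix.genericDet ℂ fun a b : Fin (d i) => (⟨i, a, b⟩ : Σ i, Fin (d i) × Fin (d i)))

theorem eval_factorPoly (i : Fin n) (x : S → ℂ) :
    MvPolynomial.eval x (factorPoly e i) =
      (e ((coeffₗ S).symm (moebiusEquiv S x)) i).det := by
  rw [factorPoly, MvPolynomial.eval_linearSubst, Matrix.eval_genericDet]
  rfl

theorem factorPoly_irreducible (i : Fin n) [NeZero (d i)] : Irreducible (factorPoly e i) := by
  refine MvPolynomial.irreducible_linearSubst _
    (Matrix.irreducible_genericDet (NeZero.ne _) _ ?_)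
  rintro ⟨a, b⟩ ⟨a', b'⟩ h
  simpa using h

theorem factorPoly_isHomogeneous (i : Fin n) : (factorPoly e i).IsHomogeneous (d i) :=
  MvPolynomial.linearSubst_isHomogeneous _ (Matrix.genericDet_isHomogeneous _)

/-- Evaluate at the point whose algebra element is the `i`-th central idempotent: the values are `1`
and, as `d j > 0`, `0`. -/
theorem factorPoly_not_associated [∀ i, NeZero (d i)] {i j : Fin n} (hij : i ≠ j) :
    ¬ Associated (factorPoly e i) (factorPoly e j) := by
  classical
  intro h
  let x : S → ℂ := (moebiusEquiv S).symm (coeffₗ S (e.symm (Pi.single i 1)))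
  have hx : (coeffₗ S).symm (moebiusEquiv S x) = e.symm (Pi.single i 1) := by
    simp only [x, LinearEquiv.apply_symm_apply, LinearEquiv.symm_apply_apply]
  have h' := h.map (MvPolynomial.eval x)
  rw [eval_factorPoly, eval_factorPoly, hx, AlgEquiv.apply_symm_apply, Pi.single_eq_same,
    Pi.single_eq_of_ne hij.symm, Matrix.det_one,
    Matrix.det_zero, associated_zero_iff_eq_zero] at h'
  exact one_ne_zero h'

theorem norm_eq_prod_det (f : GroupoidAlgebra S) :
    Algebra.norm ℂ f = ∏ i, (e f i).det ^ d i := by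
  rw [← Matrix.norm_pi_matrix, Algebra.norm_apply, Algebra.norm_apply,
    ← LinearMap.det_conj _ e.toLinearEquiv]
  congr 1
  refine LinearMap.ext fun x => ?_
  simp

theorem exists_semigroupDet_eq : ∃ ε : ℂ, ε ≠ 0 ∧ (IsEmpty S → ε = 1) ∧
    semigroupDet S = MvPolynomial.C ε * ∏ i, factorPoly e i ^ d i := by
  classical
  obtain ⟨ε, h0, h1, h⟩ := det_composableMatrix (S := S)
  refine ⟨ε, h0, h1, MvPolynomial.funext fun x => ?_⟩
  rw [eval_semigroupDet, map_mul, MvPolynomial.eval_C, map_prod]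
  simp only [map_pow, eval_factorPoly]
  rw [← norm_eq_prod_det, ← det_leftMatrix, coeffₗ_symm_coeff, ← h]

theorem isEmpty_of_card_factors_eq_zero
    (e : GroupoidAlgebra S ≃ₐ[ℂ] Π i, Matrix (Fin (d i)) (Fin (d i)) ℂ) (hn : n = 0) : IsEmpty S := by
  subst hn
  by_contra hS
  rw [not_isEmpty_iff] at hS
  obtain ⟨s⟩ := hS
  have h : lower s = 0 := e.injective (Subsingleton.elim _ _)
  exact (lowerBasis S).ne_zero s (by rw [lowerBasis_apply, h])

theorem exists_scalars [∀ i, NeZero (d i)] : ∃ c : Fin n → ℂ, (∀ i, c i ≠ 0) ∧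
    semigroupDet S = ∏ i, (MvPolynomial.C (c i) * factorPoly e i) ^ d i := by
  obtain ⟨ε, h0, h1, h⟩ := exists_semigroupDet_eq e
  obtain ⟨c, hc, hprod⟩ : ∃ c : Fin n → ℂ, (∀ i, c i ≠ 0) ∧ ∏ i, c i ^ d i = ε := by
    rcases Nat.eq_zero_or_pos n with hn | hn
    · have := isEmpty_of_card_factors_eq_zero e hn
      subst hn
      exact ⟨1, fun i => i.elim0, by rw [h1 this]; simp⟩
    · let i₀ : Fin n := ⟨0, hn⟩
      -- A `d i₀`-th root of `ε` lets one factor absorb the sign, so no constant remains in front of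
      -- the product.
      obtain ⟨z, hz⟩ := IsAlgClosed.exists_pow_nat_eq ε (NeZero.pos (d i₀))
      have hz0 : z ≠ 0 := by
        rintro rfl
        rw [zero_pow (NeZero.ne _)] at hz
        exact h0 hz.symm
      refine ⟨fun i => if i = i₀ then z else 1, fun i => ?_, ?_⟩
      · dsimp only
        split_ifs
        exacts [hz0, one_ne_zero]
      · rw [Finset.prod_eq_single i₀]
        · simp only [if_true, hz]
        · intro i _ hi
          simp only [if_neg hi, one_pow]
        · simp
  refine ⟨c, hc, ?_⟩
  rw [h, ← hprod]
  simp only [mul_pow, Finset.prod_mul_distrib, map_prod, map_pow]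

-- The inverse Möbius transform sums a function over all `t ≤ u`; applied to the indicator of the
-- idempotents, it counts them.
open Classical in
theorem moebiusEquiv_card_idempotents :
    moebiusEquiv S (fun u => ((Finset.univ.filter fun e : S =>
      IsIdempotentElem e ∧ NatLE e u).card : ℂ)) = (1 : GroupoidAlgebra S).coeff := by
  rw [← LinearEquiv.eq_symm_apply, moebiusEquiv_symm_apply]
  funext u
  rw [Matrix.mulVec, dotProduct, Finset.card_filter, Nat.cast_sum]
  refine Finset.sum_congr rfl fun t _ => ?_
  rw [zetaMatrix_apply, coeff_lower, coeff_one]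
  split_ifs <;> first | (simp; done) | (exfalso; tauto)

open Classical in
theorem moebiusEquiv_card_lower (s : S) :
    moebiusEquiv S (fun u => ((Finset.univ.filter fun v : S =>
      NatLE v u ∧ NatLE v s).card : ℂ)) = (lower s).coeff := by
  rw [← LinearEquiv.eq_symm_apply, moebiusEquiv_symm_apply]
  funext u
  rw [Matrix.mulVec, dotProduct, Finset.card_filter, Nat.cast_sum]
  refine Finset.sum_congr rfl fun t _ => ?_
  rw [zetaMatrix_apply, coeff_lower, coeff_lower]
  split_ifs <;> first | (simp; done) | (exfalso; tauto)

/-- The two counting functions in the substitution are the coordinates of `1` and of `lower s`,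
whose components in factor `i` are the identity and `ρ_i(s)`. -/
theorem specializeAt_factorPoly (i : Fin n) (s : S) :
    specializeAt s (factorPoly e i) = (factorRep e i s).charpoly := by
  classical
  rw [← MvPolynomial.aeval_linearSubst_genericDet (entriesEquiv e).toLinearMap
    (fun a b : Fin (d i) => (⟨i, a, b⟩ : Σ i, Fin (d i) × Fin (d i)))
    (fun u => ((Finset.univ.filter fun e : S => IsIdempotentElem e ∧ NatLE e u).card : ℂ))
    (fun u => ((Finset.univ.filter fun v : S => NatLE v u ∧ NatLE v s).card : ℂ))
    (factorRep e i s)]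
  · simp only [specializeAt, factorPoly, map_natCast]
  · intro a b
    rw [LinearEquiv.coe_coe, entriesEquiv_apply, moebiusEquiv_card_idempotents]
    change e 1 i a b = _
    rw [map_one, Pi.one_apply]
  · intro a b
    rw [LinearEquiv.coe_coe, entriesEquiv_apply, moebiusEquiv_card_lower]
    rfl

end Wedderburn

end

end GroupoidAlgebra

open GroupoidAlgebra in
theorem theoremt (S : Type*) [Semigroup S] [Fintype S] [IsInverseSemigroup S] :
    (∃ (d : Fin (numConjClasses S) → ℕ)
      (ρ : ∀ i, S →ₙ* Matrix (Fin (d i)) (Fin (d i)) ℂ)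
      (P : Fin (numConjClasses S) → MvPolynomial S ℂ),
      -- the `ρ i` are a complete set of pairwise inequivalent irreducible representations
      (∀ i, IsIrreducibleRep (ρ i)) ∧
      (∀ i j, i ≠ j → ¬ RepEquiv (ρ i) (ρ j)) ∧
      (∀ (e : ℕ) (σ : S →ₙ* Matrix (Fin e) (Fin e) ℂ),
        IsIrreducibleRep σ → ∃ i, RepEquiv σ (ρ i)) ∧
      -- the `P i` are distinct (even up to scalars), irreducible and homogeneous of degree `d i`
      (∀ i, Irreducible (P i) ∧ (P i).IsHomogeneous (d i)) ∧
      (∀ i j, i ≠ j → ¬ Associated (P i) (P j)) ∧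
      -- the factorization
      semigroupDet S = ∏ i, P i ^ d i ∧
      -- `P i` determines the character of `ρ i`
      (∀ i, ∃ c : ℂ, c ≠ 0 ∧ ∀ s,
        specializeAt s (P i) = Polynomial.C c * (ρ i s).charpoly) ∧
      (∀ i s, (ρ i s).trace =
        -(specializeAt s (P i)).coeff (d i - 1) / (specializeAt s (P i)).coeff (d i))) ∧
    -- reduction to the determinant of the underlying groupoid
    semigroupDet S =
      MvPolynomial.aeval (fun a => InverseSemigroup.yForm (InverseSemigroup.arrowElem a))
        (categoryDet (InverseSemigroup.UnderlyingGroupoid S)) := by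
  refine ⟨?_, semigroupDet_eq_categoryDet⟩
  obtain ⟨n, d, hd, ⟨e⟩⟩ :=
    IsSemisimpleRing.exists_algEquiv_pi_matrix_of_isAlgClosed ℂ (GroupoidAlgebra S)
  obtain rfl := card_factors e
  obtain ⟨c, hc, hdet⟩ := exists_scalars e
  have hassoc (i) : Associated (MvPolynomial.C (c i) * factorPoly e i) (factorPoly e i) :=
    associated_unit_mul_left _ _ ((isUnit_iff_ne_zero.2 (hc i)).map MvPolynomial.C)
  have hspec (i s) : specializeAt s (MvPolynomial.C (c i) * factorPoly e i) =
      Polynomial.C (c i) * (factorRep e i s).charpoly := by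
    rw [← specializeAt_factorPoly]
    simp only [specializeAt, map_mul, MvPolynomial.aeval_C]
    rfl
  refine ⟨d, factorRep e, fun i => MvPolynomial.C (c i) * factorPoly e i,
    fun i => factorRep_irreducible e i, fun i j => factorRep_not_equiv e,
    fun m σ => exists_repEquiv_factorRep e σ, fun i => ⟨?_, ?_⟩, fun i j hij h => ?_, hdet,
    fun i => ⟨c i, hc i, hspec i⟩, fun i s => ?_⟩
  · exact (hassoc i).irreducible_iff.2 (factorPoly_irreducible e i)
  · simpa using (MvPolynomial.isHomogeneous_C S (c i)).mul (factorPoly_isHomogeneous e i)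
  · exact factorPoly_not_associated e hij (((hassoc i).symm.trans h).trans (hassoc j))
  -- The characteristic polynomial is monic, so the top coefficient after specialization is exactly
  -- `c i`, which cancels in the quotient.
  · have hlead : (factorRep e i s).charpoly.coeff (d i) = 1 := by
      have h := (factorRep e i s).charpoly_monic.coeff_natDegree
      rwa [Matrix.charpoly_natDegree_eq_dim, Fintype.card_fin] at h
    rw [hspec, Polynomial.coeff_C_mul, Polynomial.coeff_C_mul, hlead,
      Matrix.trace_eq_neg_charpoly_coeff, Fintype.card_fin]
    field_simp [hc i]
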